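/- A \emph{vincular pattern} of length $k$ is a pair $(\sigma,T)$ with $\sigma\in S_k$ and $T\subseteq\{1,\dots,k-1\}$. A permutation $\pi\in S_n$ \emph{contains} $(\sigma,T)$ if there are indices $1\le i_1<\dots<i_k\le n$ such that $\pi_{i_1}\cdots\pi_{i_k}$ is order-isomorphic to $\sigma_1\cdots\sigma_k$ and $i_{j+1}=i_j+1$ for all $j\in T$; otherwise $\pi$ \emph{avoids} it. Two vincular patterns are \emph{Wilf-equivalent} if, for every positive integer $n$, they are avoided by the same number of permutations in $S_n$. A \emph{quasi-consecutive} pattern of length $5$ is one with $T=\{1,2,3\}$; it is written $abcd\text{-}e$, where $abcde=\sigma_1\sigma_2\sigma_3\sigma_4\sigma_5$. Its \emph{complement} is the quasi-consecutive pattern obtained by replacing each letter $v$ by $6-v$. **Theorem.** The $120$ quasi-consecutive patterns of length $5$ fall into exactly $26$ Wilf-equivalence classes. They are the $26$ sets A, …, Z each of which consists of the patterns in the corresponding row below together with their complements: - A: 1254-3, 1354-2 - B: 1453-2, 1543-2 - C: 2135-4, 2145-3 - D: 1534-2 - E: 2315-4 - F: 1243-5, 1253-4, 2134-5, 2354-1,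 3145-2, 3245-1 - G: 3125-4, 3215-4 - H: 1523-4 - I: 3251-4 - J: 2154-3 - K: 1435-2 - L: 3124-5, 3214-5, 2543-1, 2453-1, 2341-5, 2431-5, 1342-5, 1432-5, 1352-4, 1452-3, 1532-4, 1542-3, 2531-4, 2541-3, 2351-4, 2451-3 - M: 2153-4, 3154-2 - N: 2513-4 - O: 1524-3 - P: 2415-3 - Q: 1325-4 - R: 1423-5, 2314-5, 2534-1, 3241-5 - S: 2143-5, 3254-1 - T: 3152-4 - U: 1425-3 - V: 1324-5, 2435-1 - W: 2514-3 - X: 2413-5, 3142-5 - Y: 1235-4, 1245-3, 1345-2 - Z: 1234-5, 2345-1 -/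

import Mathlib

/-- Two sequences are order-isomorphic if their entries compare in the same way. -/
def OrderIsomorphic {k : ℕ} {α β : Type*} [LT α] [LT β] (a : Fin k → α) (b : Fin k → β) : Prop :=
  ∀ i j : Fin k, a i < a j ↔ b i < b j

/-- A vincular pattern of length `k`: a permutation together with a set of adjacencies.
Positions and values are counted from `0`; `j ∈ adj` (with `0 ≤ j < k - 1`) says that the
entries at positions `j` and `j + 1` have to be adjacent, i.e. that there is no dash between
them. -/
structure VincularPattern (k : ℕ) where
  perm : Equiv.Perm (Fin k)
  adj : Set (Fin (k - 1))

namespace VincularPattern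

variable {k : ℕ}

/-- The permutation `π` of `n` letters contains the vincular pattern `p`. -/
def ContainedIn {n : ℕ} (p : VincularPattern k) (π : Equiv.Perm (Fin n)) : Prop :=
  ∃ i : Fin k → Fin n, StrictMono i ∧
    OrderIsomorphic (fun a => π (i a)) (fun a => p.perm a) ∧
    ∀ j ∈ p.adj,
      (i ⟨(j : ℕ) + 1, by omega⟩ : ℕ) = (i ⟨(j : ℕ), by omega⟩ : ℕ) + 1

/-- The set of permutations of `n` letters that avoid the vincular pattern `p`. -/
def avoiders (p : VincularPattern k) (n : ℕ) : Set (Equiv.Perm (Fin n)) :=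
  {π | ¬ p.ContainedIn π}

/-- Wilf-equivalence of vincular patterns. -/
def WilfEquiv {l : ℕ} (p : VincularPattern k) (q : VincularPattern l) : Prop :=
  ∀ n : ℕ, 0 < n → (p.avoiders n).ncard = (q.avoiders n).ncard

/-- A pattern is quasi-consecutive if it has exactly one dash, before its last letter. -/
def IsQuasiConsecutive (p : VincularPattern k) : Prop :=
  ∀ j : Fin (k - 1), j ∈ p.adj ↔ (j : ℕ) + 2 < k

/-- The complement of a pattern: every value `v` of `1, …, k` is replaced by `k + 1 - v`, and the
adjacencies are kept. -/
def complement (p : VincularPattern k) : VincularPattern k where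
  perm := p.perm.trans Fin.revPerm
  adj := p.adj

/-- The word `σ₁ σ₂ ⋯ σ_k` of a pattern, with letters `1, …, k`. -/
def word (p : VincularPattern k) : List ℕ :=
  List.ofFn fun i => (p.perm i : ℕ) + 1

end VincularPattern

/-- Quasi-consecutive vincular patterns of length `k`. -/
abbrev QuasiConsecutivePattern (k : ℕ) : Type :=
  {p : VincularPattern k // p.IsQuasiConsecutive}

/-- Wilf-equivalence as an equivalence relation on quasi-consecutive patterns of length `k`. -/
def wilfSetoid (k : ℕ) : Setoid (QuasiConsecutivePattern k) where
  r p q := p.1.WilfEquiv q.1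
  iseqv :=
    { refl := fun _ _ _ => rfl
      symm := fun h n hn => (h n hn).symm
      trans := fun h h' n hn => (h n hn).trans (h' n hn) }

/-- The table of the 26 classes. The entry `[a, b, c, d, e]` stands for the pattern `abcd-e`; of a
pattern and its complement only the lexicographically smaller one is recorded. -/
def classTable : List (List (List ℕ)) :=
  [
    /- A -/ [[1, 2, 5, 4, 3], [1, 3, 5, 4, 2]],
    /- B -/ [[1, 4, 5, 3, 2], [1, 5, 4, 3, 2]],
    /- C -/ [[2, 1, 3, 5, 4], [2, 1, 4, 5, 3]],
    /- D -/ [[1, 5, 3, 4, 2]],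
    /- E -/ [[2, 3, 1, 5, 4]],
    /- F -/ [[1, 2, 4, 3, 5], [1, 2, 5, 3, 4], [2, 1, 3, 4, 5], [2, 3, 5, 4, 1],
      [3, 1, 4, 5, 2], [3, 2, 4, 5, 1]],
    /- G -/ [[3, 1, 2, 5, 4], [3, 2, 1, 5, 4]],
    /- H -/ [[1, 5, 2, 3, 4]],
    /- I -/ [[3, 2, 5, 1, 4]],
    /- J -/ [[2, 1, 5, 4, 3]],
    /- K -/ [[1, 4, 3, 5, 2]],
    /- L -/ [[3, 1, 2, 4, 5], [3, 2, 1, 4, 5], [2, 5, 4, 3, 1], [2, 4, 5, 3, 1],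
      [2, 3, 4, 1, 5], [2, 4, 3, 1, 5], [1, 3, 4, 2, 5], [1, 4, 3, 2, 5],
      [1, 3, 5, 2, 4], [1, 4, 5, 2, 3], [1, 5, 3, 2, 4], [1, 5, 4, 2, 3],
      [2, 5, 3, 1, 4], [2, 5, 4, 1, 3], [2, 3, 5, 1, 4], [2, 4, 5, 1, 3]],
    /- M -/ [[2, 1, 5, 3, 4], [3, 1, 5, 4, 2]],
    /- N -/ [[2, 5, 1, 3, 4]],
    /- O -/ [[1, 5, 2, 4, 3]],
    /- P -/ [[2, 4, 1, 5, 3]],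
    /- Q -/ [[1, 3, 2, 5, 4]],
    /- R -/ [[1, 4, 2, 3, 5], [2, 3, 1, 4, 5], [2, 5, 3, 4, 1], [3, 2, 4, 1, 5]],
    /- S -/ [[2, 1, 4, 3, 5], [3, 2, 5, 4, 1]],
    /- T -/ [[3, 1, 5, 2, 4]],
    /- U -/ [[1, 4, 2, 5, 3]],
    /- V -/ [[1, 3, 2, 4, 5], [2, 4, 3, 5, 1]],
    /- W -/ [[2, 5, 1, 4, 3]],
    /- X -/ [[2, 4, 1, 3, 5], [3, 1, 4, 2, 5]],
    /- Y -/ [[1, 2, 3, 5, 4], [1, 2, 4, 5, 3], [1, 3, 4, 5, 2]],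
    /- Z -/ [[1, 2, 3, 4, 5], [2, 3, 4, 5, 1]]]

/-- The set of patterns described by a row of the table: the recorded patterns and their
complements. (A quasi-consecutive pattern is determined by its word.) -/
def tableClass (row : List (List ℕ)) : Set (QuasiConsecutivePattern 5) :=
  {p | p.1.word ∈ row ∨ p.1.complement.word ∈ row}


/-!
The Lehmer code of a permutation turns order conditions into conditions on single entries: whether
an occurrence of a word `abcd-e` starts at a given position depends only on the number of code
entries from there on and on the first four of them. Avoiding permutations thus become codes without
certain windows of four entries, which can be counted according to their first entries.

* If two occurrences of `abcd` overlap in at most one position, then the numbers of codes with given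
  first entry satisfy a recursion whose coefficients are the numbers of windows with given first and
  last entries. Swapping the second and third letters, or exchanging a last letter `t + 1` with a
  letter `t` in the second or third place, preserves these numbers.
* If `e` is the largest letter, then decomposing a sequence at its largest entry shows that the
  number depends only on the consecutive pattern `abcd`, up to reversal and complement. The case of
  the smallest letter is its complement.
* An occurrence of `3154-2` or `2153-4` amounts to two descents in the code, one of which is by more
  than one. Both families of counts satisfy the same recursion, up to a shift of the first entry.
* An occurrence of `1235-4`, `1245-3` or `1345-2` amounts to a weakly increasing run of four entries
  with one strict step. Where the strict step stands does not affect the count.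

Different classes are told apart by their numbers of avoiding permutations of ten letters.
-/

/-! ### Occurrences of words in lists -/

/-- The lists `l` and `m` are order-isomorphic, which makes sense of occurrences of words in lists
without the casts between index types that `OrderIsomorphic` would need. -/
def SameOrder (l m : List ℕ) : Prop :=
  l.length = m.length ∧
    (l.zip m).Pairwise fun p q => (p.1 < q.1 ↔ p.2 < q.2) ∧ (q.1 < p.1 ↔ q.2 < p.2)

instance (l m : List ℕ) : Decidable (SameOrder l m) :=
  inferInstanceAs (Decidable (_ ∧ _))

theorem sameOrder_nil_nil : SameOrder [] [] := by decide

theorem sameOrder_cons_cons {a b : ℕ} {l m : List ℕ} : SameOrder (a :: l) (b :: m) ↔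
    (∀ p ∈ l.zip m, (a < p.1 ↔ b < p.2) ∧ (p.1 < a ↔ p.2 < b)) ∧ SameOrder l m := by
  simp only [SameOrder, List.length_cons, Nat.add_right_cancel_iff, List.zip_cons_cons,
    List.pairwise_cons, and_left_comm]

theorem sameOrder_iff_getElem {l m : List ℕ} : SameOrder l m ↔ ∃ h : l.length = m.length,
    ∀ i j (_ : i < l.length) (_ : j < l.length), l[i] < l[j] ↔ m[i] < m[j] := by
  rw [SameOrder, List.pairwise_iff_getElem, ← exists_prop]
  refine exists_congr fun h => ?_
  simp only [List.length_zip, ← h, min_self, List.getElem_zip]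
  refine ⟨fun H i j hi hj => ?_, fun H i j hi hj _ => ⟨H i j hi hj, H j i hj hi⟩⟩
  rcases lt_trichotomy i j with hij | rfl | hij
  · exact (H i j hi hj hij).1
  · simp only [lt_irrefl]
  · exact (H j i hj hi hij).2

theorem sameOrder_ofFn {k : ℕ} {f g : Fin k → ℕ} :
    SameOrder (List.ofFn f) (List.ofFn g) ↔ OrderIsomorphic f g := by
  simp only [sameOrder_iff_getElem, List.length_ofFn, List.getElem_ofFn, exists_true_left]
  exact ⟨fun H i j => H i j i.2 j.2, fun H i j hi hj => H ⟨i, hi⟩ ⟨j, hj⟩⟩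

namespace SameOrder

variable {l m r : List ℕ}

theorem symm (h : SameOrder l m) : SameOrder m l := by
  obtain ⟨hl, h⟩ := sameOrder_iff_getElem.1 h
  exact sameOrder_iff_getElem.2
    ⟨hl.symm, fun i j hi hj => (h i j (hl ▸ hi) (hl ▸ hj)).symm⟩

theorem trans (h : SameOrder l m) (h' : SameOrder m r) : SameOrder l r := by
  obtain ⟨hl, h⟩ := sameOrder_iff_getElem.1 h
  obtain ⟨hm, h'⟩ := sameOrder_iff_getElem.1 h'
  exact sameOrder_iff_getElem.2 ⟨hl.trans hm, fun i j hi hj =>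
    (h i j hi hj).trans (h' i j (hl ▸ hi) (hl ▸ hj))⟩

theorem nodup (h : SameOrder l m) (hm : m.Nodup) : l.Nodup := by
  obtain ⟨hl, h⟩ := sameOrder_iff_getElem.1 h
  rw [List.nodup_iff_injective_get]
  intro i j hij
  have hij' : l[(i : ℕ)] = l[(j : ℕ)] := hij
  have h₁ := h i j i.2 j.2
  have h₂ := h j i j.2 i.2
  rw [hij'] at h₁ h₂
  exact Fin.ext ((hm.getElem_inj_iff).1 (le_antisymm (by simpa using h₂) (by simpa using h₁)))

theorem take (h : SameOrder l m) (i : ℕ) : SameOrder (l.take i) (m.take i) := by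
  refine ⟨by rw [List.length_take, List.length_take, h.1], ?_⟩
  rw [List.zip, ← List.take_zipWith]
  exact h.2.sublist (List.take_sublist _ _)

theorem drop (h : SameOrder l m) (i : ℕ) : SameOrder (l.drop i) (m.drop i) := by
  refine ⟨by rw [List.length_drop, List.length_drop, h.1], ?_⟩
  rw [List.zip, ← List.drop_zipWith]
  exact h.2.sublist (List.drop_sublist _ _)

theorem reverse (h : SameOrder l m) : SameOrder l.reverse m.reverse := by
  obtain ⟨hl, h⟩ := sameOrder_iff_getElem.1 h
  refine sameOrder_iff_getElem.2 ⟨by simpa using hl, fun i j hi hj => ?_⟩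
  simp only [List.length_reverse] at hi hj
  simp only [List.getElem_reverse, ← hl]
  exact h _ _ _ _

end SameOrder

theorem sameOrder_map_iff {f : ℕ → ℕ} (hf : StrictMono f) {l m : List ℕ} :
    SameOrder (l.map f) m ↔ SameOrder l m := by
  simp only [SameOrder, List.length_map, List.zip_map_left, List.pairwise_map, Prod.map_fst,
    Prod.map_snd, id, hf.lt_iff_lt]

theorem sameOrder_map_map_iff_of_anti {f g : ℕ → ℕ} {l m : List ℕ}
    (hf : StrictAntiOn f {v | v ∈ l}) (hg : StrictAntiOn g {v | v ∈ m}) :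
    SameOrder (l.map f) (m.map g) ↔ SameOrder l m := by
  simp only [sameOrder_iff_getElem, List.length_map, List.getElem_map]
  refine exists_congr fun h => ?_
  have key : ∀ i j (hi : i < l.length) (hj : j < l.length),
      (f l[i] < f l[j] ↔ g m[i] < g m[j]) ↔ (l[j] < l[i] ↔ m[j] < m[i]) := fun i j hi hj => by
    rw [hf.lt_iff_gt (List.getElem_mem _) (List.getElem_mem _),
      hg.lt_iff_gt (List.getElem_mem _) (List.getElem_mem _)]
  exact ⟨fun H i j hi hj => (key j i hj hi).1 (H j i hj hi),
    fun H i j hi hj => (key i j hi hj).2 (H j i hj hi)⟩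

theorem sameOrder_append_singleton_iff {l σ : List ℕ} {u e : ℕ} (he : e ∉ σ) :
    SameOrder (l ++ [u]) (σ ++ [e]) ↔
      SameOrder l σ ∧ ∀ p ∈ l.zip σ, (p.2 < e → p.1 < u) ∧ (e < p.2 → u < p.1) := by
  simp only [SameOrder, List.length_append, List.length_singleton, Nat.add_right_cancel_iff,
    and_assoc]
  refine and_congr_right fun h => ?_
  rw [List.zip_append h, List.pairwise_append]
  simp only [List.zip_cons_cons, List.zip_nil_right, List.pairwise_singleton, List.mem_singleton,
    forall_eq, true_and]
  refine and_congr_right fun _ => forall₂_congr fun p hp => ?_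
  have hpe : p.2 ≠ e := fun h => he (h ▸ (List.of_mem_zip hp).2)
  omega

/-- Some suffix of `l` satisfies `C`. For a property `C` of the beginning of a list this says that
the property holds somewhere in `l`. -/
def HasSuffix (C : List ℕ → Prop) (l : List ℕ) : Prop := ∃ s, s <:+ l ∧ C s

theorem hasSuffix_nil {C : List ℕ → Prop} : HasSuffix C [] ↔ C [] := by
  simp only [HasSuffix, List.suffix_nil, exists_eq_left]

theorem hasSuffix_cons {C : List ℕ → Prop} {x : ℕ} {l : List ℕ} :
    HasSuffix C (x :: l) ↔ C (x :: l) ∨ HasSuffix C l := by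
  simp only [HasSuffix, List.suffix_cons_iff, or_and_right, exists_or, exists_eq_left]

theorem hasSuffix_map {C D : List ℕ → Prop} {f : ℕ → ℕ} {l : List ℕ}
    (h : ∀ s, s <:+ l → (C (s.map f) ↔ D s)) : HasSuffix C (l.map f) ↔ HasSuffix D l := by
  constructor
  · rintro ⟨s, hs, hC⟩
    obtain ⟨t, ht, rfl⟩ := List.suffix_map_iff.1 hs
    exact ⟨t, ht, (h t ht).1 hC⟩
  · rintro ⟨s, hs, hD⟩
    exact ⟨s.map f, hs.map f, (h s hs).2 hD⟩

/-- The list `s` begins with an occurrence of the consecutive word `σ`. -/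
def BeginsWith (σ s : List ℕ) : Prop := SameOrder (s.take σ.length) σ

/-- The list `s` begins with an occurrence of the word `w`, which is read with a dash before its
last letter: the last entry of the occurrence may be anywhere to the right of the others. -/
def BeginsWithDashed (w s : List ℕ) : Prop :=
  ∃ u ∈ s.drop (w.length - 1), SameOrder (s.take (w.length - 1) ++ [u]) w

theorem beginsWithDashed_map {f : ℕ → ℕ} (hf : StrictMono f) {w s : List ℕ} :
    BeginsWithDashed w (s.map f) ↔ BeginsWithDashed w s := by
  simp only [BeginsWithDashed, ← List.map_drop, ← List.map_take, List.mem_map,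
    exists_exists_and_eq_and, ← List.map_singleton, ← List.map_append, sameOrder_map_iff hf]

theorem beginsWith_map_map_of_anti {f g : ℕ → ℕ} {σ s : List ℕ}
    (hf : StrictAntiOn f {v | v ∈ s}) (hg : StrictAntiOn g {v | v ∈ σ}) :
    BeginsWith (σ.map g) (s.map f) ↔ BeginsWith σ s := by
  rw [BeginsWith, List.length_map, ← List.map_take]
  exact sameOrder_map_map_iff_of_anti (hf.mono fun _ => List.mem_of_mem_take) hg

theorem beginsWithDashed_map_map_of_anti {f g : ℕ → ℕ} {w s : List ℕ}
    (hf : StrictAntiOn f {v | v ∈ s}) (hg : StrictAntiOn g {v | v ∈ w}) :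
    BeginsWithDashed (w.map g) (s.map f) ↔ BeginsWithDashed w s := by
  simp only [BeginsWithDashed, List.length_map, ← List.map_drop, ← List.map_take,
    List.mem_map, exists_exists_and_eq_and, ← List.map_singleton, ← List.map_append]
  refine exists_congr fun u => and_congr_right fun hu => sameOrder_map_map_iff_of_anti ?_ hg
  refine hf.mono fun v hv => ?_
  rcases List.mem_append.1 hv with hv | hv
  · exact List.mem_of_mem_take hv
  · exact List.mem_singleton.1 hv ▸ List.mem_of_mem_drop hu

theorem hasSuffix_beginsWith_iff_isInfix {σ l : List ℕ} :
    HasSuffix (BeginsWith σ) l ↔ ∃ s, s <:+: l ∧ SameOrder s σ := by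
  constructor
  · rintro ⟨s, hs, h⟩
    exact ⟨_, (List.take_prefix _ _).isInfix.trans hs.isInfix, h⟩
  · rintro ⟨s, ⟨p, q, rfl⟩, h⟩
    refine ⟨s ++ q, ⟨p, by rw [List.append_assoc]⟩, ?_⟩
    rwa [BeginsWith, ← h.1, List.take_left]

theorem hasSuffix_beginsWith_reverse {σ l : List ℕ} :
    HasSuffix (BeginsWith σ.reverse) l.reverse ↔ HasSuffix (BeginsWith σ) l := by
  simp only [hasSuffix_beginsWith_iff_isInfix]
  exact ⟨fun ⟨s, hs, h⟩ => ⟨s.reverse, by simpa using List.reverse_infix.2 hs,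
    by simpa using h.reverse⟩, fun ⟨s, hs, h⟩ => ⟨s.reverse, List.reverse_infix.2 hs, h.reverse⟩⟩

/-! ### Lehmer codes -/

/-- The strictly increasing map from `ℕ` to `ℕ` that omits exactly the value `x`. -/
def skip (x y : ℕ) : ℕ := if y < x then y else y + 1

/-- The injective sequence with a given Lehmer code: an entry `x` of the code is the rank of the
corresponding entry of the sequence among the values not used to its left. -/
def decode : List ℕ → List ℕ
  | [] => []
  | x :: c => x :: (decode c).map (skip x)

/-- The strictly increasing map onto the values that the sequence with code `p` does not use. -/
def relabel : List ℕ → ℕ → ℕ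
  | [] => id
  | x :: p => skip x ∘ relabel p

/-- The entries of `c` satisfy `c_i < N - i`, so that `c` encodes an injective sequence with values
in `{0, …, N - 1}`. -/
def IsCode : ℕ → List ℕ → Prop
  | _, [] => True
  | N, x :: c => x < N ∧ IsCode (N - 1) c

/-- The sum of `φ` over the codes of length `j` of injective sequences in `{0, …, N - 1}`. -/
def codeSum : ℕ → ℕ → (List ℕ → ℕ) → ℕ
  | _, 0, φ => φ []
  | N, j + 1, φ => ∑ x ∈ Finset.range N, codeSum (N - 1) j fun c => φ (x :: c)

theorem skip_lt_skip_iff {x a b : ℕ} : skip x a < skip x b ↔ a < b := by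
  unfold skip; split_ifs <;> omega

theorem lt_skip_iff {x y : ℕ} : x < skip x y ↔ x ≤ y := by
  unfold skip; split_ifs <;> omega

theorem skip_lt_iff {x y : ℕ} : skip x y < x ↔ y < x := by
  unfold skip; split_ifs <;> omega

theorem skip_lt_succ_iff {x u N : ℕ} (hx : x < N + 1) : skip x u < N + 1 ↔ u < N := by
  unfold skip; split_ifs <;> omega

theorem strictMono_skip (x : ℕ) : StrictMono (skip x) := fun _ _ => skip_lt_skip_iff.2

theorem exists_skip_eq {x v : ℕ} (h : v ≠ x) : ∃ u, skip x u = v := by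
  rcases Nat.lt_or_gt_of_ne h with h | h
  · exact ⟨v, if_pos h⟩
  · exact ⟨v - 1, by unfold skip; split_ifs <;> omega⟩

theorem length_decode (c : List ℕ) : (decode c).length = c.length := by
  induction c with
  | nil => rfl
  | cons x c ih => simp only [decode, List.length_cons, List.length_map, ih]

theorem mem_decode_iff {c : List ℕ} (hc : IsCode c.length c) {v : ℕ} :
    v ∈ decode c ↔ v < c.length := by
  induction c generalizing v with
  | nil => simp [decode]
  | cons x c ih =>
    obtain ⟨hx, hc⟩ := hc
    rw [List.length_cons] at hx ⊢
    simp only [decode, List.mem_cons, List.mem_map, ih hc]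
    constructor
    · rintro (rfl | ⟨u, hu, rfl⟩)
      · exact hx
      · exact (skip_lt_succ_iff hx).2 hu
    · intro hv
      refine or_iff_not_imp_left.2 fun h => ?_
      obtain ⟨u, rfl⟩ := exists_skip_eq h
      exact ⟨u, (skip_lt_succ_iff hx).1 hv, rfl⟩

theorem strictMono_relabel (p : List ℕ) : StrictMono (relabel p) := by
  induction p with
  | nil => exact strictMono_id
  | cons x p ih => exact (strictMono_skip x).comp ih

theorem exists_relabel_eq {p : List ℕ} {v : ℕ} (h : v ∉ decode p) : ∃ u, relabel p u = v := by
  induction p generalizing v with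
  | nil => exact ⟨v, rfl⟩
  | cons x p ih =>
    rw [decode, List.mem_cons, not_or] at h
    obtain ⟨w, rfl⟩ := exists_skip_eq h.1
    obtain ⟨u, rfl⟩ := ih fun hw => h.2 (List.mem_map_of_mem hw)
    exact ⟨u, rfl⟩

theorem relabel_succ {p : List ℕ} {y : ℕ} (h : relabel p y + 1 ∉ decode p) :
    relabel p (y + 1) = relabel p y + 1 := by
  obtain ⟨z, hz⟩ := exists_relabel_eq h
  have hyz : y < z := (strictMono_relabel p).lt_iff_lt.1 (by omega)
  have hle : relabel p (y + 1) ≤ relabel p z := (strictMono_relabel p).monotone hyz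
  exact le_antisymm (hle.trans_eq hz) (strictMono_relabel p (Nat.lt_succ_self y))

theorem exists_eq_succ_of_relabel_eq_succ {p : List ℕ} {y v : ℕ} (hv : v ∉ decode p)
    (h : relabel p y = v + 1) : ∃ z, y = z + 1 ∧ relabel p z = v := by
  obtain ⟨z, rfl⟩ := exists_relabel_eq hv
  have hzy : z < y := (strictMono_relabel p).lt_iff_lt.1 (by omega)
  have hle : relabel p y ≤ relabel p (z + 1) :=
    h.trans_le (strictMono_relabel p (Nat.lt_succ_self z))
  exact ⟨z, le_antisymm ((strictMono_relabel p).le_iff_le.1 hle) hzy, rfl⟩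

theorem IsCode.relabel_lt_iff {N u : ℕ} {p : List ℕ} (hp : IsCode N p) :
    relabel p u < N ↔ u < N - p.length := by
  induction p generalizing N with
  | nil => rfl
  | cons x p ih =>
    obtain ⟨hx, hp⟩ := hp
    obtain ⟨M, rfl⟩ := Nat.exists_eq_add_of_lt hx
    rw [Nat.add_sub_cancel] at hp
    rw [relabel, Function.comp_apply, skip_lt_succ_iff hx, ih hp, List.length_cons,
      Nat.add_sub_add_right]

theorem decode_append (p t : List ℕ) :
    decode (p ++ t) = decode p ++ (decode t).map (relabel p) := by
  induction p with
  | nil => simp [decode, relabel]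
  | cons x p ih => simp [decode, relabel, ih]

theorem take_decode (i : ℕ) (c : List ℕ) : (decode c).take i = decode (c.take i) := by
  have h := decode_append (c.take i) (c.drop i)
  rw [List.take_append_drop] at h
  rcases le_total i c.length with hi | hi
  · rw [h, List.take_left' (by rw [length_decode, List.length_take_of_le hi])]
  · rw [List.take_of_length_le hi, List.take_of_length_le (by rwa [length_decode])]

theorem sameOrder_drop_decode_iff {i : ℕ} {c m : List ℕ} :
    SameOrder ((decode c).drop i) m ↔ SameOrder (decode (c.drop i)) m := by
  rcases le_total i c.length with hi | hi
  · have h := decode_append (c.take i) (c.drop i)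
    rw [List.take_append_drop] at h
    rw [h, List.drop_left' (by rw [length_decode, List.length_take_of_le hi]),
      sameOrder_map_iff (strictMono_relabel _)]
  · rw [List.drop_of_length_le hi, List.drop_of_length_le (by rwa [length_decode])]; rfl

theorem hasSuffix_decode_iff {C : List ℕ → Prop}
    (hC : ∀ f s, StrictMono f → (C (s.map f) ↔ C s)) {c : List ℕ} :
    HasSuffix C (decode c) ↔ HasSuffix (fun s => C (decode s)) c := by
  induction c with
  | nil => simp [HasSuffix, decode]
  | cons x c ih =>
    rw [decode, hasSuffix_cons, hasSuffix_cons, ← ih,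
      hasSuffix_map fun s _ => hC (skip x) s (strictMono_skip x), decode]

theorem IsCode.of_suffix {s c : List ℕ} (hs : s <:+ c) (hc : IsCode c.length c) :
    IsCode s.length s := by
  induction c with
  | nil => rwa [List.suffix_nil.1 hs]
  | cons x c ih =>
    rcases List.suffix_cons_iff.1 hs with rfl | hs
    · exact hc
    · exact ih hs hc.2

theorem codeSum_congr {N j : ℕ} {φ ψ : List ℕ → ℕ}
    (h : ∀ c, c.length = j → IsCode N c → φ c = ψ c) : codeSum N j φ = codeSum N j ψ := by
  induction j generalizing N φ ψ with
  | zero => exact h [] rfl trivial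
  | succ j ih =>
    exact Finset.sum_congr rfl fun x hx => ih fun c hc hv =>
      h _ (congrArg (· + 1) hc) ⟨Finset.mem_range.1 hx, hv⟩

theorem codeSum_add (N j : ℕ) (φ ψ : List ℕ → ℕ) :
    codeSum N j (fun c => φ c + ψ c) = codeSum N j φ + codeSum N j ψ := by
  induction j generalizing N φ ψ with
  | zero => rfl
  | succ j ih => simp only [codeSum, ih, Finset.sum_add_distrib]

theorem codeSum_const_mul (N j a : ℕ) (φ : List ℕ → ℕ) :
    codeSum N j (fun c => a * φ c) = a * codeSum N j φ := by
  induction j generalizing N φ with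
  | zero => rfl
  | succ j ih => simp only [codeSum, ih, Finset.mul_sum]

theorem codeSum_zero (N j : ℕ) : codeSum N j (fun _ => 0) = 0 := by
  simpa using codeSum_const_mul N j 0 fun _ => 0

theorem codeSum_finset_sum {ι : Type*} (s : Finset ι) (N j : ℕ) (φ : ι → List ℕ → ℕ) :
    codeSum N j (fun c => ∑ i ∈ s, φ i c) = ∑ i ∈ s, codeSum N j (φ i) := by
  classical
  induction s using Finset.induction_on with
  | empty => simpa using codeSum_zero N j
  | insert i s hi ih => simp only [Finset.sum_insert hi, codeSum_add, ih]

theorem codeSum_append (N i j : ℕ) (φ : List ℕ → ℕ) :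
    codeSum N (i + j) φ = codeSum N i fun l => codeSum (N - i) j fun r => φ (l ++ r) := by
  induction i generalizing N φ with
  | zero => simp [codeSum]
  | succ i ih =>
    rw [Nat.add_right_comm]
    simp only [codeSum, ih, List.cons_append, Nat.sub_sub, Nat.add_comm 1]

theorem codeSum_split_first_max (n : ℕ) (φ : List ℕ → ℕ) : codeSum (n + 1) (n + 1) φ =
    ∑ j ∈ Finset.range (n + 1), codeSum n j fun l =>
      codeSum (n - j) (n - j) fun r => φ (l ++ (n - j) :: r) := by
  induction n generalizing φ with
  | zero => rfl
  | succ n ih =>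
    rw [codeSum, Nat.add_sub_cancel, Finset.sum_range_succ, Finset.sum_range_succ' _ (n + 1)]
    congr 1
    simp only [ih]
    rw [Finset.sum_comm]
    simp only [codeSum, Nat.add_sub_cancel, Nat.add_sub_add_right, List.cons_append]

/-- Prepending a first entry to an injective sequence, whose other values are then relabelled. -/
def consEmbedding {j N : ℕ} (p : Fin (N + 1) × (Fin j ↪ Fin N)) : Fin (j + 1) ↪ Fin (N + 1) where
  toFun := Fin.cons p.1 (p.1.succAbove ∘ p.2)
  inj' := Fin.cons_injective_iff.2
    ⟨fun ⟨_, hi⟩ => Fin.succAbove_ne _ _ hi, Fin.succAbove_right_injective.comp p.2.injective⟩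

theorem consEmbedding_bijective {j N : ℕ} :
    Function.Bijective (consEmbedding : Fin (N + 1) × (Fin j ↪ Fin N) → _) := by
  constructor
  · rintro ⟨x, f⟩ ⟨y, g⟩ h
    have h' : (Fin.cons x (x.succAbove ∘ f) : Fin (j + 1) → Fin (N + 1)) =
        Fin.cons y (y.succAbove ∘ g) := congrArg DFunLike.coe h
    obtain ⟨rfl, h'⟩ := Fin.cons_inj.1 h'
    exact Prod.ext rfl (DFunLike.ext _ _ fun i => Fin.succAbove_right_injective (congrFun h' i))
  · intro f
    have h (i : Fin j) : ∃ y, (f 0).succAbove y = f i.succ :=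
      Fin.exists_succAbove_eq fun h => Fin.succ_ne_zero i (f.injective h)
    choose g hg using h
    have hg_inj : Function.Injective g := fun a b hab =>
      Fin.succ_injective _ (f.injective (by rw [← hg, ← hg, hab]))
    exact ⟨⟨f 0, g, hg_inj⟩, DFunLike.ext _ _ (Fin.cases rfl hg)⟩

theorem val_succAbove_eq_skip {N : ℕ} (x : Fin (N + 1)) (y : Fin N) :
    (x.succAbove y : ℕ) = skip x y := by
  unfold skip Fin.succAbove
  simp only [Fin.lt_def, Fin.val_castSucc]
  split_ifs <;> simp

/-- The values of an injective sequence, as a list. -/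
def valueList {j N : ℕ} (f : Fin j ↪ Fin N) : List ℕ := List.ofFn fun i => (f i : ℕ)

theorem valueList_consEmbedding {j N : ℕ} (x : Fin (N + 1)) (f : Fin j ↪ Fin N) :
    valueList (consEmbedding (x, f)) = (x : ℕ) :: (valueList f).map (skip x) := by
  simp [valueList, consEmbedding, List.ofFn_succ, List.map_ofFn, val_succAbove_eq_skip,
    Function.comp_def]

theorem codeSum_decode (N j : ℕ) (ψ : List ℕ → ℕ) :
    codeSum N j (fun c => ψ (decode c)) = ∑ f : Fin j ↪ Fin N, ψ (valueList f) := by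
  induction j generalizing N ψ with
  | zero => simp [codeSum, decode, valueList]
  | succ j ih =>
    rcases N with _ | N
    · have : IsEmpty (Fin (j + 1) ↪ Fin 0) := ⟨fun f => (f 0).elim0⟩
      simp [codeSum]
    · simp only [← consEmbedding_bijective.sum_comp, Fintype.sum_prod_type, codeSum,
        Nat.add_sub_cancel, decode, Finset.sum_range, valueList_consEmbedding]
      exact Finset.sum_congr rfl fun x _ => ih N fun l => ψ (x :: l.map (skip x))

theorem valueList_rev {j N : ℕ} (f : Fin j ↪ Fin N) :
    valueList (Equiv.embeddingCongr Fin.revPerm (Equiv.refl (Fin N)) f) =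
      (valueList f).reverse := by
  refine List.ext_getElem (by simp [valueList]) fun i h₁ h₂ => ?_
  simp only [valueList, List.getElem_ofFn, List.getElem_reverse, List.length_ofFn]
  change (f (Fin.rev _) : ℕ) = _
  congr 2
  exact Fin.ext (by simp only [Fin.val_rev]; omega)

theorem valueList_complement {j N : ℕ} (f : Fin j ↪ Fin N) :
    valueList (Equiv.embeddingCongr (Equiv.refl (Fin j)) Fin.revPerm f) =
      (valueList f).map fun v => N - 1 - v := by
  simp only [valueList, List.map_ofFn]
  congr 1
  funext i
  change (Fin.rev (f i) : ℕ) = _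
  rw [Fin.val_rev, Function.comp_apply, Nat.sub_sub, Nat.add_comm 1]

/-! ### Numbers of avoiding sequences and codes -/

open Classical in
/-- The indicator function of the lists in which `C` does not occur, that is, of which no suffix
satisfies `C`. -/
noncomputable def avoidWeight (C : List ℕ → Prop) (l : List ℕ) : ℕ := if HasSuffix C l then 0 else 1

/-- The number of injective sequences of length `j` in `{0, …, N - 1}` in which `C` does not
occur. -/
noncomputable def seqCount (C : List ℕ → Prop) (N j : ℕ) : ℕ :=
  ∑ f : Fin j ↪ Fin N, avoidWeight C (valueList f)

/-- The number of permutations of `n` letters that avoid the word `w`, read with a dash before its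
last letter. -/
noncomputable def wordCount (w : List ℕ) (n : ℕ) : ℕ := seqCount (BeginsWithDashed w) n n

/-- The number of Lehmer codes of length `n` in which `C` does not occur. -/
noncomputable def avoidCount (C : List ℕ → Prop) (n : ℕ) : ℕ := codeSum n n (avoidWeight C)

/-- The number of Lehmer codes of length `p.length + m` that begin with `p` and in which `C` does
not occur. -/
noncomputable def prefixCount (C : List ℕ → Prop) (p : List ℕ) (m : ℕ) : ℕ :=
  codeSum m m fun c => avoidWeight C (p ++ c)

open Classical in
theorem avoidWeight_congr {C D : List ℕ → Prop} {l m : List ℕ}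
    (h : HasSuffix C l ↔ HasSuffix D m) : avoidWeight C l = avoidWeight D m :=
  if_congr h rfl rfl

open Classical in
theorem avoidWeight_cons (C : List ℕ → Prop) (x : ℕ) (l : List ℕ) :
    avoidWeight C (x :: l) = if C (x :: l) then 0 else avoidWeight C l := by
  simp only [avoidWeight, hasSuffix_cons, ite_or]

theorem avoidWeight_cons_of_not {C : List ℕ → Prop} {x : ℕ} {l : List ℕ} (h : ¬ C (x :: l)) :
    avoidWeight C (x :: l) = avoidWeight C l := by
  rw [avoidWeight_cons, if_neg h]

theorem avoidCount_succ (C : List ℕ → Prop) (m : ℕ) :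
    avoidCount C (m + 1) = ∑ x ∈ Finset.range (m + 1), prefixCount C [x] m := rfl

theorem avoidCount_congr {C D : List ℕ → Prop}
    (h : ∀ s, IsCode s.length s → (C s ↔ D s)) (n : ℕ) : avoidCount C n = avoidCount D n :=
  codeSum_congr fun _ hc hv => avoidWeight_congr <| exists_congr fun s =>
    and_congr_right fun hs => h s (IsCode.of_suffix hs (hc ▸ hv))

theorem avoidCount_eq_of_prefixCount_eq {C D : List ℕ → Prop}
    (h : ∀ m, ∀ x ≤ m, prefixCount C [x] m = prefixCount D [x] m)
    (h₀ : avoidCount C 0 = avoidCount D 0) (n : ℕ) : avoidCount C n = avoidCount D n := by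
  rcases n with _ | m
  · exact h₀
  · exact Finset.sum_congr rfl fun x hx => h m x (Finset.mem_range_succ_iff.1 hx)

theorem seqCount_eq_codeSum {C : List ℕ → Prop}
    (hC : ∀ f s, StrictMono f → (C (s.map f) ↔ C s)) (N j : ℕ) :
    seqCount C N j = codeSum N j (avoidWeight fun s => C (decode s)) := by
  rw [seqCount, ← codeSum_decode]
  exact codeSum_congr fun c _ _ => avoidWeight_congr (hasSuffix_decode_iff hC)

theorem seqCount_beginsWith_reverse (σ : List ℕ) (N j : ℕ) :
    seqCount (BeginsWith σ.reverse) N j = seqCount (BeginsWith σ) N j := by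
  rw [seqCount, ← (Equiv.embeddingCongr Fin.revPerm (Equiv.refl (Fin N))).sum_comp]
  refine Finset.sum_congr rfl fun f _ => avoidWeight_congr ?_
  rw [valueList_rev, hasSuffix_beginsWith_reverse]

theorem strictAntiOn_sub (M : ℕ) : StrictAntiOn (M - ·) {v | v ≤ M} := fun _ _ _ hb hab =>
  Nat.sub_lt_sub_left (hab.trans_le hb) hab

theorem seqCount_eq_of_anti {C D : List ℕ → Prop}
    (h : ∀ f s, StrictAntiOn f {v | v ∈ s} → (C (s.map f) ↔ D s)) (N j : ℕ) :
    seqCount C N j = seqCount D N j := by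
  rw [seqCount, ← (Equiv.embeddingCongr (Equiv.refl (Fin j)) Fin.revPerm).sum_comp]
  refine Finset.sum_congr rfl fun f _ => avoidWeight_congr ?_
  rw [valueList_complement]
  refine hasSuffix_map fun s hs => h _ s ((strictAntiOn_sub (N - 1)).mono fun v hv => ?_)
  obtain ⟨i, rfl⟩ := List.mem_ofFn.1 (hs.subset hv)
  exact Nat.le_sub_one_of_lt (f i).2

theorem wordCount_map_of_anti {g : ℕ → ℕ} {w : List ℕ} (hg : StrictAntiOn g {v | v ∈ w}) (n : ℕ) :
    wordCount (w.map g) n = wordCount w n :=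
  seqCount_eq_of_anti (fun _ _ hf => beginsWithDashed_map_map_of_anti hf hg) n n

theorem seqCount_beginsWith_map_of_anti {g : ℕ → ℕ} {σ : List ℕ}
    (hg : StrictAntiOn g {v | v ∈ σ}) (N j : ℕ) :
    seqCount (BeginsWith (σ.map g)) N j = seqCount (BeginsWith σ) N j :=
  seqCount_eq_of_anti (fun _ _ hf => beginsWith_map_map_of_anti hf hg) N j

/-- The codes of length `n` that begin with `c` encode sequences that begin with an occurrence of
`w`, read with a dash before its last letter, where `c` has one entry less than `w`. As such a
sequence takes all the values `u < n`, the rest of the code does not matter. -/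
def WindowOccurrence (w : List ℕ) (n : ℕ) (c : List ℕ) : Prop :=
  ∃ u < n, SameOrder (decode c ++ [u]) w

instance (w : List ℕ) (n : ℕ) (c : List ℕ) : Decidable (WindowOccurrence w n c) :=
  inferInstanceAs (Decidable (∃ u < n, _))

/-- The code `s` begins with an occurrence of `w`, read with a dash before its last letter. -/
def CodeOccurrence (w s : List ℕ) : Prop := WindowOccurrence w s.length (s.take (w.length - 1))

theorem beginsWithDashed_decode_iff {w s : List ℕ} (hw : w.Nodup) (hs : IsCode s.length s) :
    BeginsWithDashed w (decode s) ↔ CodeOccurrence w s := by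
  simp only [BeginsWithDashed, CodeOccurrence, WindowOccurrence, take_decode, ← mem_decode_iff hs]
  refine exists_congr fun u => and_congr_left fun h => ⟨List.mem_of_mem_drop, fun hu => ?_⟩
  rw [← List.take_append_drop (w.length - 1) (decode s), List.mem_append, take_decode] at hu
  exact hu.resolve_left fun hu =>
    List.disjoint_of_nodup_append (h.nodup hw) hu (List.mem_singleton_self u)

theorem wordCount_eq_avoidCount {w : List ℕ} (hw : w.Nodup) (n : ℕ) :
    wordCount w n = avoidCount (CodeOccurrence w) n :=
  (seqCount_eq_codeSum (fun _ _ hf => beginsWithDashed_map hf) n n).trans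
    (avoidCount_congr (fun _ hs => beginsWithDashed_decode_iff hw hs) n)

/-! ### Quasi-consecutive patterns as words -/

namespace VincularPattern

variable {k n : ℕ}

theorem word_complement (p : VincularPattern k) :
    p.complement.word = p.word.map fun v => k + 1 - v := by
  simp only [word, complement, List.map_ofFn]
  congr 1
  funext i
  simp only [Equiv.trans_apply, Fin.revPerm_apply, Fin.val_rev, Function.comp_apply]
  omega

theorem wordCount_word_complement (p : VincularPattern k) (n : ℕ) :
    wordCount p.complement.word n = wordCount p.word n := by
  rw [word_complement]
  refine wordCount_map_of_anti ((strictAntiOn_sub (k + 1)).mono fun v hv => ?_) n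
  obtain ⟨i, rfl⟩ := List.mem_ofFn.1 hv
  exact Nat.succ_le_succ (p.perm i).2.le

theorem take_drop_append_eq_ofFn {f : Fin n → ℕ} {i : Fin (k + 1) → Fin n} {d : ℕ}
    (hd : d + k ≤ n) (hi : ∀ a : Fin k, (i a.castSucc : ℕ) = d + a) :
    ((List.ofFn f).drop d).take k ++ [f (i (Fin.last k))] = List.ofFn (f ∘ i) := by
  rw [List.ofFn_succ', List.concat_eq_append, Function.comp_apply]
  congr 1
  refine List.ext_getElem (by simp; omega) fun a h₁ h₂ => ?_
  simp only [List.getElem_take, List.getElem_drop, List.getElem_ofFn, Function.comp_apply]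
  exact congrArg f (Fin.ext (hi ⟨a, by simpa using h₂⟩).symm)

theorem sameOrder_ofFn_word_iff {p : VincularPattern k} {π : Fin n → Fin n} {i : Fin k → Fin n} :
    SameOrder (List.ofFn ((fun a => (π a : ℕ)) ∘ i)) p.word ↔
      OrderIsomorphic (fun a => π (i a)) fun a => p.perm a := by
  simp only [word, sameOrder_ofFn, OrderIsomorphic, Function.comp_apply, Nat.add_lt_add_iff_right,
    Fin.val_fin_lt]

theorem ContainedIn.hasSuffix {p : VincularPattern (k + 1)} (hp : p.IsQuasiConsecutive)
    {π : Equiv.Perm (Fin n)} (h : p.ContainedIn π) :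
    HasSuffix (BeginsWithDashed p.word) (List.ofFn fun i => (π i : ℕ)) := by
  obtain ⟨i, hi, hiso, hadj⟩ := h
  have hblock : ∀ a (ha : a < k), (i ⟨a, by omega⟩ : ℕ) = i 0 + a := fun a ha => by
    induction a with
    | zero => rfl
    | succ a ih =>
      rw [hadj ⟨a, by omega⟩ ((hp _).2 (by change a + 2 < k + 1; omega)), ih (by omega),
        Nat.add_assoc]
  have hlast : (i 0 : ℕ) + k ≤ i (Fin.last k) := by
    rcases k with _ | k
    · rfl
    · have : i ⟨k, by omega⟩ < i (Fin.last (k + 1)) := hi (Nat.lt_succ_self k)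
      have := hblock k (by omega)
      omega
  refine ⟨_, List.drop_suffix (i 0) _, π (i (Fin.last k)), ?_, ?_⟩
  · rw [word, List.length_ofFn, List.drop_drop, List.mem_drop_iff_getElem]
    exact ⟨i (Fin.last k) - (i 0 + k), by simp; omega, by simp [Nat.add_sub_cancel' hlast]⟩
  · rw [word, List.length_ofFn, Nat.add_sub_cancel, take_drop_append_eq_ofFn
      (f := fun a => (π a : ℕ)) (by omega) (fun a => hblock a a.2)]
    exact sameOrder_ofFn_word_iff.2 hiso

theorem containedIn_of_hasSuffix {p : VincularPattern (k + 1)} (hp : p.IsQuasiConsecutive)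
    {π : Equiv.Perm (Fin n)}
    (h : HasSuffix (BeginsWithDashed p.word) (List.ofFn fun i => (π i : ℕ))) :
    p.ContainedIn π := by
  obtain ⟨s, hs, u, hu, h⟩ := h
  rw [List.suffix_iff_eq_drop] at hs
  generalize (List.ofFn fun i => (π i : ℕ)).length - s.length = d at hs
  subst hs
  rw [word, List.length_ofFn, Nat.add_sub_cancel] at hu h
  rw [List.drop_drop, List.mem_drop_iff_getElem] at hu
  obtain ⟨e, he, rfl⟩ := hu
  rw [List.length_ofFn] at he
  rw [List.getElem_ofFn] at h
  let i : Fin (k + 1) → Fin n := Fin.snoc (fun a : Fin k => ⟨d + a, by omega⟩) ⟨d + k + e, by omega⟩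
  have hblock (a : Fin k) : (i a.castSucc : ℕ) = d + a := by simp only [i, Fin.snoc_castSucc]
  have hlast : i (Fin.last k) = ⟨d + k + e, by omega⟩ := Fin.snoc_last _ _
  refine ⟨i, ?_, ?_, ?_⟩
  · intro a b hab
    induction a using Fin.lastCases with
    | last => exact absurd hab (Fin.le_last b).not_gt
    | cast a =>
      induction b using Fin.lastCases with
      | last => rw [hlast, Fin.lt_def, hblock]; change _ < d + k + e; omega
      | cast b =>
        rw [Fin.lt_def, hblock, hblock]
        exact Nat.add_lt_add_left hab d
  · rw [← hlast, take_drop_append_eq_ofFn (f := fun a => (π a : ℕ)) (by omega) hblock] at h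
    exact sameOrder_ofFn_word_iff.1 h
  · intro j hj
    have hj := (hp j).1 hj
    exact (hblock ⟨j + 1, by omega⟩).trans (congrArg (· + 1) (hblock ⟨j, by omega⟩).symm)

theorem ncard_avoiders {p : VincularPattern (k + 1)} (hp : p.IsQuasiConsecutive) (n : ℕ) :
    (p.avoiders n).ncard = wordCount p.word n := by
  classical
  have hπ (π : Equiv.Perm (Fin n)) : avoidWeight (BeginsWithDashed p.word)
      (valueList ((Equiv.embeddingEquivOfFinite (Fin n)).symm π)) =
        if π ∈ p.avoiders n then 1 else 0 := by
    rw [avoidWeight, ← ite_not]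
    exact if_congr (not_congr ⟨containedIn_of_hasSuffix hp, ContainedIn.hasSuffix hp⟩) rfl rfl
  rw [wordCount, seqCount, ← (Equiv.embeddingEquivOfFinite (Fin n)).symm.sum_comp]
  simp only [hπ, Finset.sum_boole, Set.ncard_eq_toFinset_card', Nat.cast_id]
  congr 1
  ext π
  simp

end VincularPattern

/-! ### Words whose last letter is the largest -/

theorem sameOrder_append_singleton_iff_of_lt {l σ : List ℕ} {u e : ℕ} (he : ∀ v ∈ σ, v < e) :
    SameOrder (l ++ [u]) (σ ++ [e]) ↔ SameOrder l σ ∧ ∀ v ∈ l, v < u := by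
  rw [sameOrder_append_singleton_iff fun h => (he e h).false]
  refine and_congr_right fun h => ⟨fun H v hv => ?_, fun H p hp => ?_⟩
  · rw [← List.map_fst_zip h.1.le] at hv
    obtain ⟨p, hp, rfl⟩ := List.mem_map.1 hv
    exact (H p hp).1 (he _ (List.of_mem_zip hp).2)
  · exact ⟨fun _ => H _ (List.of_mem_zip hp).1,
      fun h => absurd (he _ (List.of_mem_zip hp).2) h.not_gt⟩

theorem beginsWithDashed_append_cons_iff {σ L R : List ℕ} {e M : ℕ} (he : ∀ v ∈ σ, v < e)
    (hL : ∀ v ∈ L, v < M) (hR : ∀ v ∈ R, v < M) :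
    BeginsWithDashed (σ ++ [e]) (L ++ M :: R) ↔ BeginsWith σ L := by
  simp only [BeginsWithDashed, BeginsWith, List.length_append, List.length_singleton,
    Nat.add_sub_cancel, sameOrder_append_singleton_iff_of_lt he]
  constructor
  · rintro ⟨u, hu, h, hlt⟩
    rcases le_or_gt σ.length L.length with hσ | hσ
    · rwa [List.take_append_of_le_length hσ] at h
    · have hM : M < u := hlt M (List.mem_take_iff_getElem.2 ⟨L.length, by simp; omega, by simp⟩)
      rcases List.mem_append.1 (List.mem_of_mem_drop hu) with hu | hu
      · exact absurd (hL u hu) hM.not_gt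
      · rcases List.mem_cons.1 hu with rfl | hu
        · exact absurd hM (lt_irrefl _)
        · exact absurd (hR u hu) hM.not_gt
  · intro h
    have hσ : σ.length ≤ L.length := h.1 ▸ List.length_take_le' _ _
    refine ⟨M, ?_, ?_⟩
    · rw [List.drop_append_of_le_length hσ]
      exact List.mem_append_right _ List.mem_cons_self
    · rw [List.take_append_of_le_length hσ]
      exact ⟨h, fun v hv => hL v (List.mem_of_mem_take hv)⟩

theorem hasSuffix_beginsWithDashed_append_cons_iff {σ L R : List ℕ} {e M : ℕ}
    (he : ∀ v ∈ σ, v < e) (hL : ∀ v ∈ L, v < M) (hR : ∀ v ∈ R, v < M) :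
    HasSuffix (BeginsWithDashed (σ ++ [e])) (L ++ M :: R) ↔
      HasSuffix (BeginsWith σ) L ∨ HasSuffix (BeginsWithDashed (σ ++ [e])) R := by
  induction L with
  | nil =>
    have h := beginsWithDashed_append_cons_iff he hL hR
    rw [List.nil_append] at h ⊢
    rw [hasSuffix_cons, h, hasSuffix_nil]
  | cons x L ih =>
    rw [hasSuffix_cons, or_assoc, ← ih fun v hv => hL v (List.mem_cons_of_mem x hv),
      ← beginsWithDashed_append_cons_iff he hL hR, List.cons_append, hasSuffix_cons]

theorem avoidWeight_append_cons {σ L R : List ℕ} {e M : ℕ}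
    (he : ∀ v ∈ σ, v < e) (hL : ∀ v ∈ L, v < M) (hR : ∀ v ∈ R, v < M) :
    avoidWeight (BeginsWithDashed (σ ++ [e])) (L ++ M :: R) =
      avoidWeight (BeginsWith σ) L * avoidWeight (BeginsWithDashed (σ ++ [e])) R := by
  classical
  rw [avoidWeight, if_congr (hasSuffix_beginsWithDashed_append_cons_iff he hL hR) rfl rfl, ite_or]
  unfold avoidWeight
  split_ifs <;> rfl

theorem IsCode.lt_of_mem_decode {N v : ℕ} {c : List ℕ} (hc : IsCode N c) (hv : v ∈ decode c) :
    v < N := by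
  induction c generalizing N v with
  | nil => simp [decode] at hv
  | cons x c ih =>
    obtain ⟨hx, hc⟩ := hc
    rcases List.mem_cons.1 hv with rfl | hv
    · exact hx
    · obtain ⟨u, hu, rfl⟩ := List.mem_map.1 hv
      have := ih hc hu
      unfold skip
      split_ifs <;> omega

theorem IsCode.relabel_eq_add_length {x : ℕ} {l : List ℕ} (hl : IsCode (x + l.length) l) :
    relabel l x = x + l.length := by
  induction l with
  | nil => rfl
  | cons a l ih =>
    obtain ⟨ha, hl⟩ := hl
    rw [relabel, Function.comp_apply, ih hl]
    exact if_neg (by rw [List.length_cons] at ha; omega)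

/-- Since the last letter is the largest, the dashed word occurs to the left of the maximum or with
the maximum as its last entry exactly when the part before the dash occurs to the left of the
maximum. -/
theorem wordCount_append_singleton_succ {σ : List ℕ} {e : ℕ} (he : ∀ v ∈ σ, v < e) (n : ℕ) :
    wordCount (σ ++ [e]) (n + 1) = ∑ j ∈ Finset.range (n + 1),
      seqCount (BeginsWith σ) n j * wordCount (σ ++ [e]) (n - j) := by
  simp only [wordCount, seqCount, ← codeSum_decode, codeSum_split_first_max]
  refine Finset.sum_congr rfl fun j hj => ?_
  rw [mul_comm, ← codeSum_const_mul]
  refine codeSum_congr fun l hl hcode => ?_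
  rw [mul_comm, ← codeSum_const_mul]
  have hj : n - j + l.length = n := by rw [hl]; have := Finset.mem_range.1 hj; omega
  have hmax : relabel l (n - j) = n :=
    (IsCode.relabel_eq_add_length (hj.symm ▸ hcode)).trans hj
  refine codeSum_congr fun r _ hr => ?_
  rw [decode_append, decode, List.map_cons, hmax,
    avoidWeight_append_cons he fun v => hcode.lt_of_mem_decode]
  · rw [avoidWeight_congr (hasSuffix_map fun s _ => beginsWithDashed_map (strictMono_relabel l)),
      avoidWeight_congr (hasSuffix_map fun s _ => beginsWithDashed_map (strictMono_skip (n - j)))]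
  · simp only [List.mem_map, exists_exists_and_eq_and, forall_exists_index, and_imp,
      forall_apply_eq_imp_iff₂]
    intro u hu
    exact (strictMono_relabel l (skip_lt_iff.2 (hr.lt_of_mem_decode hu))).trans_eq hmax

theorem wordCount_zero (w : List ℕ) : wordCount w 0 = 1 := by
  simp [wordCount, seqCount, valueList, avoidWeight, HasSuffix, BeginsWithDashed]

theorem wordCount_append_singleton_congr {σ τ : List ℕ} {e e' : ℕ} (he : ∀ v ∈ σ, v < e)
    (he' : ∀ v ∈ τ, v < e')
    (h : ∀ N j, seqCount (BeginsWith σ) N j = seqCount (BeginsWith τ) N j) (n : ℕ) :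
    wordCount (σ ++ [e]) n = wordCount (τ ++ [e']) n := by
  induction n using Nat.strong_induction_on with
  | _ n ih =>
    rcases n with _ | n
    · rw [wordCount_zero, wordCount_zero]
    · rw [wordCount_append_singleton_succ he, wordCount_append_singleton_succ he']
      exact Finset.sum_congr rfl fun j _ => by rw [h, ih (n - j) (by omega)]

theorem beginsWith_congr {σ τ s : List ℕ} (h : SameOrder σ τ) :
    BeginsWith σ s ↔ BeginsWith τ s := by
  rw [BeginsWith, BeginsWith, h.1]
  exact ⟨fun hs => hs.trans h, fun hs => hs.trans h.symm⟩

theorem wordCount_reverse_append_singleton {σ : List ℕ} {e : ℕ} (he : ∀ v ∈ σ, v < e) (n : ℕ) :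
    wordCount (σ.reverse ++ [e]) n = wordCount (σ ++ [e]) n :=
  wordCount_append_singleton_congr (fun v hv => he v (List.mem_reverse.1 hv)) he
    (seqCount_beginsWith_reverse σ) n

theorem wordCount_map_sub_append_singleton {σ : List ℕ} {e : ℕ} (he : ∀ v ∈ σ, 0 < v ∧ v < e)
    (n : ℕ) : wordCount (σ.map (e - ·) ++ [e]) n = wordCount (σ ++ [e]) n := by
  refine wordCount_append_singleton_congr (fun v hv => ?_) (fun v hv => (he v hv).2)
    (seqCount_beginsWith_map_of_anti ((strictAntiOn_sub e).mono fun v hv => (he v hv).2.le)) n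
  obtain ⟨u, hu, rfl⟩ := List.mem_map.1 hv
  exact Nat.sub_lt_self (he u hu).1 (he u hu).2.le

/-- Complementing the word with the smallest last letter makes that letter the largest one, and
complementing just the part before the dash does not matter then. -/
theorem wordCount_largest_eq_smallest {σ τ : List ℕ} {e d : ℕ} (h : SameOrder σ τ)
    (he : ∀ v ∈ σ, v < e) (hd : ∀ v ∈ τ, d < v) (n : ℕ) :
    wordCount (σ ++ [e]) n = wordCount (τ ++ [d]) n := by
  have hsub : StrictAntiOn ((τ ++ [d]).sum - ·) {v | v ∈ τ ++ [d]} :=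
    (strictAntiOn_sub _).mono fun v => List.le_sum_of_mem
  have hsub' := hsub.mono fun v (hv : v ∈ τ) => List.mem_append_left [d] hv
  rw [← wordCount_map_of_anti hsub, List.map_append, List.map_singleton]
  refine wordCount_append_singleton_congr he (fun v hv => ?_) (fun N j => ?_) n
  · obtain ⟨u, hu, rfl⟩ := List.mem_map.1 hv
    exact hsub (by simp) (by simp [hu]) (hd u hu)
  · rw [seqCount_beginsWith_map_of_anti hsub']
    exact Finset.sum_congr rfl fun f _ => avoidWeight_congr <| exists_congr fun s =>
      and_congr_right fun _ => beginsWith_congr h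

/-! ### Words that do not overlap themselves -/

/-- Two occurrences of the consecutive word `σ` in a list share at most one entry. -/
def IsNonOverlapping (σ : List ℕ) : Prop :=
  ∀ i ∈ Finset.Ico 1 (σ.length - 1), ¬ SameOrder (σ.drop i) (σ.take (σ.length - i))

instance (σ : List ℕ) : Decidable (IsNonOverlapping σ) :=
  inferInstanceAs (Decidable (∀ i ∈ Finset.Ico 1 (σ.length - 1), _))

/-- The number of fillings `v`, of length `j`, for which the codes of length `m + j + 2` with
beginning `x :: v ++ [y]` begin with an occurrence of `w`. -/
def windowCount (w : List ℕ) (j m x y : ℕ) : ℕ :=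
  codeSum (m + j + 1) j fun v => if WindowOccurrence w (m + j + 2) (x :: (v ++ [y])) then 1 else 0

theorem WindowOccurrence.length_eq {w c : List ℕ} {n : ℕ} (h : WindowOccurrence w n c) :
    c.length + 1 = w.length := by
  obtain ⟨u, -, h⟩ := h
  simpa [length_decode] using h.1

theorem WindowOccurrence.sameOrder_dropLast {w c : List ℕ} {n : ℕ} (h : WindowOccurrence w n c) :
    SameOrder (decode c) w.dropLast := by
  have hlen := h.length_eq
  obtain ⟨u, -, h⟩ := h
  have h := h.take c.length
  rwa [List.take_left' (length_decode c), Nat.eq_sub_of_add_eq hlen, ← List.dropLast_eq_take] at h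

theorem CodeOccurrence.not_drop {w s : List ℕ} (hw : IsNonOverlapping w.dropLast)
    (h : CodeOccurrence w s) {i : ℕ} (hi : 1 ≤ i) (hi' : i + 2 < w.length) :
    ¬ CodeOccurrence w (s.drop i) := by
  intro h'
  refine hw i (Finset.mem_Ico.2 ⟨hi, by rw [List.length_dropLast]; omega⟩) ?_
  have h₁ := sameOrder_drop_decode_iff.1 (h.sameOrder_dropLast.drop i)
  have h₂ := h'.sameOrder_dropLast.take (w.dropLast.length - i)
  rw [take_decode, List.take_take, List.length_dropLast, min_eq_left (Nat.sub_le _ _)] at h₂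
  rw [List.drop_take] at h₁
  rw [List.length_dropLast]
  exact h₁.symm.trans h₂

theorem avoidWeight_append_of_not {C : List ℕ → Prop} {v t : List ℕ}
    (h : ∀ i < v.length, ¬ C ((v ++ t).drop i)) : avoidWeight C (v ++ t) = avoidWeight C t := by
  induction v with
  | nil => rfl
  | cons x v ih =>
    refine (avoidWeight_cons_of_not (h 0 (Nat.succ_pos _))).trans ?_
    exact ih fun i hi => h (i + 1) (Nat.succ_lt_succ hi)

theorem avoidWeight_cons_append_add {w v : List ℕ} (hw : IsNonOverlapping w.dropLast)
    (hv : v.length + 3 = w.length) {m : ℕ} (x y : ℕ) {c : List ℕ} (hc : c.length = m) :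
    avoidWeight (CodeOccurrence w) (x :: (v ++ y :: c)) +
        avoidWeight (CodeOccurrence w) (y :: c) *
          (if WindowOccurrence w (m + v.length + 2) (x :: (v ++ [y])) then 1 else 0) =
      avoidWeight (CodeOccurrence w) (v ++ y :: c) := by
  classical
  have hC : CodeOccurrence w (x :: (v ++ y :: c)) ↔
      WindowOccurrence w (m + v.length + 2) (x :: (v ++ [y])) := by
    have hlen : (x :: (v ++ y :: c)).length = m + v.length + 2 := by simp [← hc]; omega
    have htake : (x :: (v ++ y :: c)).take (w.length - 1) = x :: (v ++ [y]) := by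
      simp [← hv, List.take_append]
    rw [CodeOccurrence, hlen, htake]
  rw [avoidWeight_cons]
  simp only [hC]
  split_ifs with h
  · rw [avoidWeight_append_of_not fun i hi => (hC.2 h).not_drop hw (i := i + 1) (by omega)
      (by omega), Nat.zero_add, Nat.mul_one]
  · rfl

theorem prefixCount_add_sum_windowCount {w : List ℕ} (hw : IsNonOverlapping w.dropLast) {j : ℕ}
    (hj : j + 3 = w.length) (m x : ℕ) :
    prefixCount (CodeOccurrence w) [x] (m + j + 1) + ∑ y ∈ Finset.range (m + 1),
        prefixCount (CodeOccurrence w) [y] m * windowCount w j m x y =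
      avoidCount (CodeOccurrence w) (m + j + 1) := by
  have hsplit (φ : List ℕ → ℕ) : codeSum (m + j + 1) (m + j + 1) φ =
      codeSum (m + j + 1) j fun v => ∑ y ∈ Finset.range (m + 1), codeSum m m fun c =>
        φ (v ++ y :: c) := by
    have h := codeSum_append (m + j + 1) j (m + 1) φ
    rw [show j + (m + 1) = m + j + 1 by omega, show m + j + 1 - j = m + 1 by omega] at h
    exact h
  simp only [windowCount, ← codeSum_const_mul, ← codeSum_finset_sum]
  rw [prefixCount, avoidCount, hsplit, hsplit, ← codeSum_add]
  refine codeSum_congr fun v hv _ => ?_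
  subst hv
  rw [← Finset.sum_add_distrib]
  refine Finset.sum_congr rfl fun y _ => ?_
  rw [prefixCount, mul_comm, ← codeSum_const_mul, ← codeSum_add]
  exact codeSum_congr fun c hc _ => by
    rw [mul_comm, ← avoidWeight_cons_append_add hw hj x y hc]
    rfl

theorem avoidWeight_of_length_lt {w l : List ℕ} (h : l.length + 1 < w.length) :
    avoidWeight (CodeOccurrence w) l = 1 := by
  refine if_neg ?_
  rintro ⟨s, hs, hw⟩
  have := hw.length_eq
  rw [List.length_take] at this
  have := hs.length_le
  omega

theorem prefixCount_eq_of_windowCount_eq {w w' : List ℕ} {j : ℕ} (hw : IsNonOverlapping w.dropLast)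
    (hw' : IsNonOverlapping w'.dropLast) (hj : j + 3 = w.length) (hj' : j + 3 = w'.length)
    (h : ∀ m x y, x < m + j + 2 → windowCount w j m x y = windowCount w' j m x y) (n : ℕ) :
    ∀ x ≤ n, prefixCount (CodeOccurrence w) [x] n = prefixCount (CodeOccurrence w') [x] n := by
  induction n using Nat.strong_induction_on with
  | _ n ih =>
    intro x hx
    rcases Nat.lt_or_ge n (j + 1) with hn | hn
    · refine codeSum_congr fun c hc _ => ?_
      rw [avoidWeight_of_length_lt (by simp; omega), avoidWeight_of_length_lt (by simp; omega)]
    · obtain ⟨m, rfl⟩ := Nat.exists_eq_add_of_le' hn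
      rw [← Nat.add_assoc] at ih hx ⊢
      have hrec := prefixCount_add_sum_windowCount hw hj m x
      have hrec' := prefixCount_add_sum_windowCount hw' hj' m x
      rw [avoidCount_succ, Finset.sum_congr rfl fun y hy =>
        ih (m + j) (by omega) y (Finset.mem_range_succ_iff.1 hy), ← avoidCount_succ, ← hrec',
        Finset.sum_congr rfl fun y hy => congrArg₂ (· * ·)
          (ih m (by omega) y (Finset.mem_range_succ_iff.1 hy)) (h m x y (by omega))] at hrec
      exact Nat.add_right_cancel hrec

theorem wordCount_eq_of_windowCount_eq {w w' : List ℕ} (hnd : w.Nodup) (hnd' : w'.Nodup) {j : ℕ}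
    (hw : IsNonOverlapping w.dropLast) (hw' : IsNonOverlapping w'.dropLast)
    (hj : j + 3 = w.length) (hj' : j + 3 = w'.length)
    (h : ∀ m x y, x < m + j + 2 → windowCount w j m x y = windowCount w' j m x y) (n : ℕ) :
    wordCount w n = wordCount w' n := by
  rw [wordCount_eq_avoidCount hnd, wordCount_eq_avoidCount hnd']
  refine avoidCount_eq_of_prefixCount_eq
    (prefixCount_eq_of_windowCount_eq hw hw' hj hj' h) ?_ n
  exact (avoidWeight_of_length_lt (l := []) (by simp; omega)).trans
    (avoidWeight_of_length_lt (l := []) (by simp; omega)).symm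

/-! ### Swapping the second and third letters -/

theorem decode_cons_cons_of_le {y z : ℕ} (h : y ≤ z) (c : List ℕ) :
    decode (y :: z :: c) = y :: (z + 1) :: (decode c).map (skip y ∘ skip z) ∧
      decode ((z + 1) :: y :: c) = (z + 1) :: y :: (decode c).map (skip y ∘ skip z) := by
  constructor <;>
    simp only [decode, List.map_cons, List.map_map, List.cons.injEq, true_and, List.map_inj_left,
      Function.comp_apply]
  · exact ⟨if_neg (by omega), trivial⟩
  · refine ⟨if_pos (by omega), fun u _ => ?_⟩
    unfold skip
    split_ifs <;> omega

theorem SameOrder.swap {a b c a' b' c' : ℕ} {l m : List ℕ}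
    (h : SameOrder (a :: b :: c :: l) (a' :: b' :: c' :: m)) :
    SameOrder (a :: c :: b :: l) (a' :: c' :: b' :: m) :=
  ⟨h.1, ((List.Perm.swap _ _ _).cons _).pairwise h.2 fun h => ⟨h.2, h.1⟩⟩

theorem windowOccurrence_swap {a b c n x y z : ℕ} {τ l : List ℕ} (h : y ≤ z) :
    WindowOccurrence (a :: b :: c :: τ) n (x :: y :: z :: l) ↔
      WindowOccurrence (a :: c :: b :: τ) n (x :: (z + 1) :: y :: l) := by
  obtain ⟨h₁, h₂⟩ := decode_cons_cons_of_le h l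
  simp only [WindowOccurrence, decode.eq_2 x, h₁, h₂, List.map_cons, List.cons_append]
  exact exists_congr fun u => and_congr_right fun _ => ⟨SameOrder.swap, SameOrder.swap⟩

theorem sum_sum_range_swap {f g : ℕ → ℕ → ℕ} (hfg : ∀ y z, y ≤ z → f y z = g (z + 1) y)
    (hgf : ∀ y z, y ≤ z → g y z = f (z + 1) y) (N : ℕ) :
    ∑ y ∈ Finset.range N, ∑ z ∈ Finset.range (N - 1), f y z =
      ∑ y ∈ Finset.range N, ∑ z ∈ Finset.range (N - 1), g y z := by
  simp only [← Finset.sum_product']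
  let swap (p : ℕ × ℕ) : ℕ × ℕ := if p.1 ≤ p.2 then (p.2 + 1, p.1) else (p.2, p.1 - 1)
  have hmem : ∀ p ∈ Finset.range N ×ˢ Finset.range (N - 1),
      swap p ∈ Finset.range N ×ˢ Finset.range (N - 1) := by
    rintro ⟨y, z⟩ hp
    simp only [Finset.mem_product, Finset.mem_range] at hp
    simp only [swap]
    split_ifs <;> simp only [Finset.mem_product, Finset.mem_range] <;> omega
  have hswap (p : ℕ × ℕ) : swap (swap p) = p := by
    obtain ⟨y, z⟩ := p
    simp only [swap]
    split_ifs <;> ext <;> simp_all <;> omega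
  refine Finset.sum_nbij' swap swap hmem hmem (fun p _ => hswap p) (fun p _ => hswap p) ?_
  rintro ⟨y, z⟩ -
  simp only [swap]
  split_ifs with h
  · exact hfg y z h
  · obtain ⟨t, rfl⟩ := Nat.exists_eq_add_of_lt (not_le.1 h)
    exact (hgf z (z + t) (Nat.le_add_right z t)).symm

theorem wordCount_swap {a b c : ℕ} {τ : List ℕ} (hnd : (a :: b :: c :: τ).Nodup)
    (hτ : 2 ≤ τ.length) (hw : IsNonOverlapping (a :: b :: c :: τ).dropLast)
    (hw' : IsNonOverlapping (a :: c :: b :: τ).dropLast) (n : ℕ) :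
    wordCount (a :: b :: c :: τ) n = wordCount (a :: c :: b :: τ) n := by
  obtain ⟨i, hi⟩ := Nat.exists_eq_add_of_le' hτ
  refine wordCount_eq_of_windowCount_eq (j := i + 2) hnd
    ((((List.Perm.swap _ _ _).cons _).nodup_iff).1 hnd) hw hw' (by simp [hi]) (by simp [hi]) ?_ n
  intro m x y _
  refine sum_sum_range_swap (fun u v huv => ?_) (fun u v huv => ?_) _ <;>
    exact codeSum_congr fun l _ _ => if_congr (windowOccurrence_swap huv) rfl rfl

/-! ### Exchanging the last letter with its predecessor -/

theorem sameOrder_append_cons_append_singleton_iff {P R σ τ : List ℕ} {V u a b : ℕ}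
    (hP : P.length = σ.length) : SameOrder (P ++ V :: R ++ [u]) (σ ++ a :: τ ++ [b]) ↔
      SameOrder (V :: u :: (P ++ R)) (a :: b :: (σ ++ τ)) := by
  have hlen : (P ++ V :: R ++ [u]).length = (σ ++ a :: τ ++ [b]).length ↔
      R.length = τ.length := by simp [hP]
  have hlen' : (V :: u :: (P ++ R)).length = (a :: b :: (σ ++ τ)).length ↔
      R.length = τ.length := by simp [hP]
  rw [SameOrder, SameOrder, hlen, hlen']
  refine and_congr_right fun hR => List.Perm.pairwise_iff (fun h => ⟨h.2, h.1⟩) ?_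
  rw [List.append_assoc, List.append_assoc, List.zip_append hP]
  simp only [List.cons_append, List.zip_cons_cons, List.zip_append hP, List.zip_append hR]
  exact List.perm_middle.trans (.cons _ (by
    rw [← List.append_assoc]; exact List.perm_append_singleton _ _))

theorem sameOrder_cons_cons_succ_iff {V u t : ℕ} {l m : List ℕ} (ht : t ∉ m) (ht' : t + 1 ∉ m) :
    SameOrder (V :: u :: l) (t :: (t + 1) :: m) ↔ SameOrder l m ∧ V < u ∧
      ∀ p ∈ l.zip m, p.1 < V ∧ p.2 < t ∨ u < p.1 ∧ t + 1 < p.2 := by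
  simp only [SameOrder, List.length_cons, Nat.add_right_cancel_iff, List.zip_cons_cons,
    List.pairwise_cons, List.forall_mem_cons]
  constructor
  · rintro ⟨hlen, ⟨⟨hVu, -⟩, hV⟩, hu, h⟩
    refine ⟨⟨hlen, h⟩, by omega, fun p hp => ?_⟩
    have := hV p hp
    have := hu p hp
    have : p.2 ≠ t := fun h => ht (h ▸ (List.of_mem_zip hp).2)
    have : p.2 ≠ t + 1 := fun h => ht' (h ▸ (List.of_mem_zip hp).2)
    omega
  · rintro ⟨⟨hlen, h⟩, hVu, H⟩
    refine ⟨hlen, ⟨by omega, fun p hp => ?_⟩, fun p hp => ?_, h⟩ <;>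
      · have := H p hp
        omega

theorem SameOrder.shrink {V u V' u' t : ℕ} {l m : List ℕ} (ht : t ∉ m) (ht' : t + 1 ∉ m)
    (h : SameOrder (V :: u :: l) (t :: (t + 1) :: m)) (hV : V ≤ V') (hlt : V' < u') (hu : u' ≤ u) :
    SameOrder (V' :: u' :: l) (t :: (t + 1) :: m) := by
  rw [sameOrder_cons_cons_succ_iff ht ht'] at h ⊢
  refine ⟨h.1, hlt, fun p hp => (h.2.2 p hp).imp (fun H => ?_) fun H => ?_⟩ <;> omega

theorem skip_succ_of_ne {y z : ℕ} (h : z ≠ y) : skip (y + 1) z = skip y z := by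
  unfold skip; split_ifs <;> omega

theorem windowOccurrence_append_cons_iff {σ τ p c : List ℕ} {a b n y : ℕ}
    (hp : p.length = σ.length) : WindowOccurrence (σ ++ a :: τ ++ [b]) n (p ++ y :: c) ↔
      ∃ u < n, SameOrder (relabel p y :: u :: (decode p ++ (decode c).map (relabel p ∘ skip y)))
        (a :: b :: (σ ++ τ)) := by
  simp only [WindowOccurrence, decode_append, decode, List.map_cons, List.map_map,
    sameOrder_append_cons_append_singleton_iff ((length_decode p).trans hp)]

theorem sameOrder_cons_cons_swap {a b a' b' : ℕ} {l m : List ℕ} :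
    SameOrder (a :: b :: l) (a' :: b' :: m) ↔ SameOrder (b :: a :: l) (b' :: a' :: m) :=
  and_congr Iff.rfl (List.Perm.pairwise_iff (fun h => ⟨h.2, h.1⟩) (.swap _ _ _))

theorem WindowOccurrence.exchange {σ τ p c : List ℕ} {n t y : ℕ}
    (hnd : (t :: (t + 1) :: (σ ++ τ)).Nodup) (hp : p.length = σ.length) (hcode : IsCode n p)
    (h : WindowOccurrence (σ ++ t :: τ ++ [t + 1]) n (p ++ y :: c)) : y + 1 < n - p.length ∧
      WindowOccurrence (σ ++ (t + 1) :: τ ++ [t]) n (p ++ (y + 1) :: c) := by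
  rw [windowOccurrence_append_cons_iff hp] at h ⊢
  obtain ⟨u, hu, h⟩ := h
  have ht : t ∉ σ ++ τ := fun h => (List.nodup_cons.1 hnd).1 (List.mem_cons_of_mem _ h)
  have ht' : t + 1 ∉ σ ++ τ := (List.nodup_cons.1 hnd.of_cons).1
  have hlt : relabel p y < u := ((sameOrder_cons_cons_succ_iff ht ht').1 h).2.1
  have h := h.shrink ht ht' le_rfl (Nat.lt_succ_self _) hlt
  have hfree := (List.nodup_cons.1 (h.nodup hnd).of_cons).1
  rw [Nat.succ_eq_add_one, List.mem_append, not_or] at hfree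
  have hsucc := relabel_succ hfree.1
  have hmap : (decode c).map (relabel p ∘ skip (y + 1)) =
      (decode c).map (relabel p ∘ skip y) := List.map_congr_left fun z hz =>
    congrArg (relabel p) (skip_succ_of_ne fun hzy => hfree.2 (List.mem_map.2
      ⟨z, hz, by rw [hzy, Function.comp_apply, ← hsucc, skip, if_neg (lt_irrefl y)]⟩))
  exact ⟨hcode.relabel_lt_iff.1 (by omega), relabel p y, by omega, by
    rw [hsucc, hmap]; exact sameOrder_cons_cons_swap.1 h⟩

theorem WindowOccurrence.exists_exchange {σ τ p c : List ℕ} {n t y : ℕ}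
    (hnd : (t :: (t + 1) :: (σ ++ τ)).Nodup) (hp : p.length = σ.length) (hcode : IsCode n p)
    (hy : y < n - p.length)
    (h : WindowOccurrence (σ ++ (t + 1) :: τ ++ [t]) n (p ++ y :: c)) :
    ∃ z, y = z + 1 ∧ WindowOccurrence (σ ++ t :: τ ++ [t + 1]) n (p ++ z :: c) := by
  simp only [windowOccurrence_append_cons_iff hp] at h ⊢
  obtain ⟨u, -, h⟩ := h
  have h := sameOrder_cons_cons_swap.1 h
  have ht : t ∉ σ ++ τ := fun h => (List.nodup_cons.1 hnd).1 (List.mem_cons_of_mem _ h)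
  have ht' : t + 1 ∉ σ ++ τ := (List.nodup_cons.1 hnd.of_cons).1
  have hlt : u < relabel p y := ((sameOrder_cons_cons_succ_iff ht ht').1 h).2.1
  obtain ⟨V, hV⟩ := Nat.exists_eq_succ_of_ne_zero (Nat.ne_zero_of_lt hlt)
  rw [hV] at h hlt
  have h := h.shrink ht ht' (Nat.le_of_lt_succ hlt) (Nat.lt_succ_self _) le_rfl
  have hfree := List.not_mem_of_not_mem_cons (List.nodup_cons.1 (h.nodup hnd)).1
  rw [List.mem_append, not_or] at hfree
  obtain ⟨z, rfl, hz⟩ := exists_eq_succ_of_relabel_eq_succ hfree.1 hV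
  have hmap : (decode c).map (relabel p ∘ skip (z + 1)) =
      (decode c).map (relabel p ∘ skip z) := List.map_congr_left fun x hx =>
    congrArg (relabel p) (skip_succ_of_ne fun hxz => hfree.2 (List.mem_map.2
      ⟨x, hx, by rw [hxz, Function.comp_apply, skip, if_pos (Nat.lt_succ_self z), hz]⟩))
  refine ⟨z, rfl, V + 1, ?_, ?_⟩
  · rw [← Nat.succ_eq_add_one, ← hV]
    exact hcode.relabel_lt_iff.2 hy
  · rwa [hz, ← hmap]

theorem sum_range_ite_eq_of_succ {p q : ℕ → Prop} [DecidablePred p] [DecidablePred q] {N : ℕ}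
    (h : ∀ y < N, p y → y + 1 < N ∧ q (y + 1)) (h' : ∀ y < N, q y → ∃ z, y = z + 1 ∧ p z) :
    (∑ y ∈ Finset.range N, if p y then 1 else 0) = ∑ y ∈ Finset.range N, if q y then 1 else 0 := by
  rcases N with _ | N
  · rfl
  · have hp : ¬ p N := fun hp => (h N (Nat.lt_succ_self N) hp).1.false
    have hq : ¬ q 0 := fun hq => by
      obtain ⟨z, hz, -⟩ := h' 0 (Nat.succ_pos N) hq
      exact Nat.succ_ne_zero z hz.symm
    rw [Finset.sum_range_succ, Finset.sum_range_succ', if_neg hp, if_neg hq]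
    refine congrArg (· + 0) (Finset.sum_congr rfl fun y hy => if_congr ?_ rfl rfl)
    have hy := Finset.mem_range.1 hy
    refine ⟨fun hpy => (h y (by omega) hpy).2, fun hqy => ?_⟩
    obtain ⟨z, hz, hpz⟩ := h' (y + 1) (by omega) hqy
    exact Nat.succ_injective hz ▸ hpz

/-- An occurrence of the word ending in `t + 1` remains one if its last entry is replaced by the
successor of the entry for `t`; exchanging these two entries gives an occurrence of the other
word. -/
theorem wordCount_exchange {σ τ : List ℕ} {t : ℕ} (hnd : (t :: (t + 1) :: (σ ++ τ)).Nodup)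
    (hσ : σ ≠ []) (hτ : τ ≠ []) (hw : IsNonOverlapping (σ ++ t :: τ))
    (hw' : IsNonOverlapping (σ ++ (t + 1) :: τ)) (n : ℕ) :
    wordCount (σ ++ t :: τ ++ [t + 1]) n = wordCount (σ ++ (t + 1) :: τ ++ [t]) n := by
  have hperm (a b : ℕ) : (σ ++ a :: τ ++ [b]).Perm (a :: b :: (σ ++ τ)) :=
    (List.perm_append_singleton b _).trans ((List.perm_middle.cons b).trans (.swap a b _))
  obtain ⟨i, hi⟩ := Nat.exists_eq_add_of_le' (List.length_pos_iff.2 hσ)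
  obtain ⟨k, hk⟩ := Nat.exists_eq_add_of_le' (List.length_pos_iff.2 hτ)
  refine wordCount_eq_of_windowCount_eq (j := i + (k + 1)) ((hperm _ _).nodup_iff.2 hnd)
    (((hperm _ _).trans (.swap _ _ _)).nodup_iff.2 hnd) (by rwa [List.dropLast_concat])
    (by rwa [List.dropLast_concat]) (by simp; omega) (by simp; omega) ?_ n
  intro m x y hx
  rw [windowCount, windowCount, codeSum_append, codeSum_append]
  refine codeSum_congr fun l hl hcode => ?_
  have hshape (z : ℕ) (r : List ℕ) :
      x :: (l ++ z :: r ++ [y]) = (x :: l) ++ z :: (r ++ [y]) := by simp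
  simp only [codeSum, ← codeSum_finset_sum, hshape]
  refine codeSum_congr fun r hr _ => ?_
  have hp : (x :: l).length = σ.length := by simp [hi, hl]
  have hcode : IsCode (m + (i + (k + 1)) + 2) (x :: l) := ⟨hx, hcode⟩
  have hrange : m + (i + (k + 1)) + 2 - (x :: l).length = m + (i + (k + 1)) + 1 - i := by
    rw [List.length_cons, hl]; omega
  refine sum_range_ite_eq_of_succ (fun z _ h => ?_) (fun z hz h => ?_)
  · rw [← hrange]
    exact WindowOccurrence.exchange hnd hp hcode h
  · exact WindowOccurrence.exists_exchange hnd hp hcode (hrange ▸ hz) h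

/-! ### Words of five letters -/

/-- The list begins with four entries that satisfy `P`. -/
def BeginsWithQuad (P : ℕ → ℕ → ℕ → ℕ → Prop) : List ℕ → Prop
  | x :: y :: z :: w :: _ => P x y z w
  | _ => False

theorem avoidWeight_beginsWithQuad_of_length_lt {P : ℕ → ℕ → ℕ → ℕ → Prop} {l : List ℕ}
    (h : l.length < 4) : avoidWeight (BeginsWithQuad P) l = 1 := by
  refine if_neg ?_
  rintro ⟨s, hs, hP⟩
  have := hs.length_le
  rcases s with _ | ⟨x, _ | ⟨y, _ | ⟨z, _ | ⟨w, s⟩⟩⟩⟩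
  iterate 4 exact hP
  simp only [List.length_cons] at this
  omega

theorem avoidCount_beginsWithQuad_zero {P : ℕ → ℕ → ℕ → ℕ → Prop} :
    avoidCount (BeginsWithQuad P) 0 = 1 :=
  avoidWeight_beginsWithQuad_of_length_lt (by simp)

theorem wordCount_eq_avoidCount_beginsWithQuad {w : List ℕ} {P : ℕ → ℕ → ℕ → ℕ → Prop}
    (hw : w.Nodup) (hlen : w.length = 5)
    (h : ∀ n a b c d, IsCode n [a, b, c, d] → (WindowOccurrence w n [a, b, c, d] ↔ P a b c d))
    (n : ℕ) : wordCount w n = avoidCount (BeginsWithQuad P) n := by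
  rw [wordCount_eq_avoidCount hw]
  refine avoidCount_congr (fun s hs => ?_) n
  rw [CodeOccurrence, hlen]
  rcases s with _ | ⟨a, _ | ⟨b, _ | ⟨c, _ | ⟨d, s⟩⟩⟩⟩
  iterate 4 exact iff_of_false (fun h => absurd h.length_eq (by simp [hlen])) id
  exact h _ _ _ _ _ ⟨hs.1, hs.2.1, hs.2.2.1, hs.2.2.2.1, trivial⟩

/-! ### The words `31542` and `21534` -/

/-- The pairs `x, y` and `z, w` are descents by more than `p` and more than `q`, and the second
descent lies above the first one in the sequence with code `x, y, z, w`. -/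
def TwoDescents (p q : ℕ) : List ℕ → Prop :=
  BeginsWithQuad fun x y z w => y + p < x ∧ x ≤ w + 1 ∧ w + q < z

/-- The number of codes of length `m + 2` that avoid two descents and begin with a descent by more
than `q`, to a value of at least `t`. -/
noncomputable def descentCount (p q m t : ℕ) : ℕ :=
  ∑ w ∈ Finset.Ico t (m + 1), ∑ z ∈ Finset.Ico (w + q + 1) (m + 2),
    prefixCount (TwoDescents p q) [z, w] m

theorem sum_Ico_sum_Ico (N M q t : ℕ) (g : ℕ → ℕ → ℕ) :
    ∑ w ∈ Finset.Ico t N, ∑ z ∈ Finset.Ico (w + q + 1) M, g z w =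
      ∑ z ∈ Finset.range M, ∑ w ∈ Finset.range N, if t ≤ w ∧ w + q < z then g z w else 0 := by
  have hIco (a b : ℕ) (h : ℕ → ℕ) :
      ∑ i ∈ Finset.Ico a b, h i = ∑ i ∈ Finset.range b, if a ≤ i then h i else 0 := by
    rw [← Finset.sum_filter]
    exact Finset.sum_congr (by ext; simp [and_comm]) fun _ _ => rfl
  simp only [hIco, ite_and, Nat.succ_le_iff]
  rw [Finset.sum_comm]
  exact Finset.sum_congr rfl fun w _ => by split_ifs <;> simp

theorem avoidWeight_twoDescents_add (p q x y z w : ℕ) (c : List ℕ) :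
    avoidWeight (TwoDescents p q) (x :: y :: z :: w :: c) +
        (if y + p < x ∧ x ≤ w + 1 ∧ w + q < z then avoidWeight (TwoDescents p q) (z :: w :: c)
          else 0) =
      avoidWeight (TwoDescents p q) (y :: z :: w :: c) := by
  classical
  have hC : TwoDescents p q (x :: y :: z :: w :: c) ↔ y + p < x ∧ x ≤ w + 1 ∧ w + q < z := Iff.rfl
  rw [avoidWeight_cons _ x, if_congr hC rfl rfl]
  split_ifs with h
  · have hy : ¬ TwoDescents p q (y :: z :: w :: c) := fun h' => by
      rcases c with _ | ⟨v, c⟩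
      · exact h'
      · have hzy : z + p < y := h'.1
        omega
    rw [avoidWeight_cons_of_not hy, Nat.zero_add]
  · rfl

theorem prefixCount_add_ite_descentCount (p q m x y : ℕ) :
    prefixCount (TwoDescents p q) [x, y] (m + 2) +
        (if y + p < x then descentCount p q m (x - 1) else 0) =
      prefixCount (TwoDescents p q) [y] (m + 2) := by
  have hdescent : (if y + p < x then descentCount p q m (x - 1) else 0) =
      ∑ z ∈ Finset.range (m + 2), ∑ w ∈ Finset.range (m + 1),
        if y + p < x ∧ x ≤ w + 1 ∧ w + q < z then prefixCount (TwoDescents p q) [z, w] m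
          else 0 := by
    rw [descentCount, sum_Ico_sum_Ico]
    by_cases h : y + p < x
    · simp only [h, if_true, true_and, Nat.sub_le_iff_le_add]
    · simp only [h, false_and, if_false, Finset.sum_const_zero]
  rw [hdescent, prefixCount, prefixCount]
  simp only [codeSum, Nat.reduceSubDiff, Nat.add_sub_cancel, ← Finset.sum_add_distrib]
  refine Finset.sum_congr rfl fun z _ => Finset.sum_congr rfl fun w _ => ?_
  simp only [← avoidWeight_twoDescents_add p q x y z w, codeSum_add, prefixCount,
    List.cons_append, List.nil_append]
  split_ifs
  · rfl
  · rw [codeSum_zero]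

theorem card_filter_add_lt {n x p : ℕ} (hx : x ≤ n) :
    ((Finset.range n).filter fun y => y + p < x).card = x - p := by
  have h : (Finset.range n).filter (fun y => y + p < x) = Finset.range (x - p) := by
    ext y
    simp only [Finset.mem_filter, Finset.mem_range]
    omega
  rw [h, Finset.card_range]

theorem prefixCount_add_descentCount (p q : ℕ) {m x : ℕ} (hx : x ≤ m + 3) :
    prefixCount (TwoDescents p q) [x] (m + 3) +
        (x - p) * descentCount p q m (x - 1) =
      avoidCount (TwoDescents p q) (m + 3) := by
  have hsplit : prefixCount (TwoDescents p q) [x] (m + 3) =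
    ∑ y ∈ Finset.range (m + 3), prefixCount (TwoDescents p q) [x, y] (m + 2) := rfl
  rw [avoidCount_succ, ← card_filter_add_lt hx, Finset.card_filter, Finset.sum_mul, hsplit,
    ← Finset.sum_add_distrib]
  exact Finset.sum_congr rfl fun y _ => by
    rw [ite_mul, one_mul, zero_mul, prefixCount_add_ite_descentCount]

theorem descentCount_add (p q m t : ℕ) : descentCount p q (m + 2) t +
      ∑ w ∈ Finset.Ico t (m + 3), ∑ z ∈ Finset.Ico (w + max p q + 1) (m + 4),
        descentCount p q m (z - 1) =
    ∑ w ∈ Finset.Ico t (m + 3), (m + 3 - (w + q)) *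
      prefixCount (TwoDescents p q) [w] (m + 2) := by
  have hfilter (w : ℕ) : Finset.Ico (w + max p q + 1) (m + 4) =
      (Finset.Ico (w + q + 1) (m + 4)).filter fun z => w + p < z := by
    ext z
    simp only [Finset.mem_filter, Finset.mem_Ico]
    omega
  simp only [hfilter, Finset.sum_filter, descentCount.eq_1 p q (m + 2), ← Finset.sum_add_distrib,
    prefixCount_add_ite_descentCount, Finset.sum_const, Nat.card_Ico, smul_eq_mul]
  exact Finset.sum_congr rfl fun w _ => congrArg (· * _) (by omega)

theorem descentCount_of_lt {p q m t : ℕ} (h : m < t + q) : descentCount p q m t = 0 :=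
  Finset.sum_eq_zero fun w hw => by
    rw [Finset.Ico_eq_empty, Finset.sum_empty]
    have := Finset.mem_Ico.1 hw
    omega

theorem sum_Ico_succ_shift {a n : ℕ} {f g : ℕ → ℕ} (hg : g n = 0)
    (h : ∀ i, a ≤ i → i < n → f (i + 1) = g i) :
    ∑ i ∈ Finset.Ico (a + 1) (n + 1), f i = ∑ i ∈ Finset.Ico a (n + 1), g i := by
  rw [← Finset.sum_Ico_add']
  have hsubset : Finset.Ico a n ⊆ Finset.Ico a (n + 1) :=
    Finset.Ico_subset_Ico_right (Nat.le_succ n)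
  rw [← Finset.sum_subset hsubset fun i hi hi' => by
    have := Finset.mem_Ico.1 hi
    rw [Finset.mem_Ico] at hi'
    rwa [show i = n by omega]]
  exact Finset.sum_congr rfl fun i hi => h i (Finset.mem_Ico.1 hi).1 (Finset.mem_Ico.1 hi).2

theorem prefixCount_twoDescents_of_lt {p q m : ℕ} (hm : m < 3) (x : ℕ) :
    prefixCount (TwoDescents p q) [x] m = codeSum m m fun _ => 1 :=
  codeSum_congr fun c hc _ => avoidWeight_beginsWithQuad_of_length_lt (by simp; omega)

theorem prefixCount_twoDescents_succ {m : ℕ}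
    (hA : avoidCount (TwoDescents 1 0) (m + 3) = avoidCount (TwoDescents 0 1) (m + 3))
    (hD : ∀ t, descentCount 1 0 m (t + 1) = descentCount 0 1 m t) {x : ℕ} (hx : x < m + 3) :
    prefixCount (TwoDescents 1 0) [x + 1] (m + 3) = prefixCount (TwoDescents 0 1) [x] (m + 3) := by
  have h := prefixCount_add_descentCount 1 0 (m := m) (x := x + 1) hx
  have h' := prefixCount_add_descentCount 0 1 hx.le
  rw [hA, ← h'] at h
  rcases x with _ | x
  · simpa using h
  · simp only [Nat.add_sub_cancel, hD, Nat.sub_zero] at h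
    exact Nat.add_right_cancel h

theorem avoidCount_twoDescents_succ {m : ℕ}
    (hA : avoidCount (TwoDescents 1 0) m = avoidCount (TwoDescents 0 1) m)
    (hF : ∀ x < m, prefixCount (TwoDescents 1 0) [x + 1] m = prefixCount (TwoDescents 0 1) [x] m) :
    avoidCount (TwoDescents 1 0) (m + 1) = avoidCount (TwoDescents 0 1) (m + 1) := by
  rw [avoidCount_succ, avoidCount_succ, Finset.sum_range_succ', Finset.sum_range_succ,
    Finset.sum_congr rfl fun x hx => hF x (Finset.mem_range.1 hx)]
  refine congrArg (_ + ·) ?_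
  rcases Nat.lt_or_ge m 3 with hm | hm
  · rw [prefixCount_twoDescents_of_lt hm, prefixCount_twoDescents_of_lt hm]
  · obtain ⟨m, rfl⟩ := Nat.exists_eq_add_of_le' hm
    have h := prefixCount_add_descentCount 1 0 (Nat.zero_le (m + 3))
    have h' := prefixCount_add_descentCount 0 1 (le_refl (m + 3))
    rw [descentCount_of_lt (t := m + 3 - 1) (by omega), Nat.mul_zero, Nat.add_zero, ← hA, ← h] at h'
    simpa using h'.symm

theorem descentCount_succ_of_lt {m : ℕ} (hm : m < 2) (t : ℕ) :
    descentCount 1 0 m (t + 1) = descentCount 0 1 m t := by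
  have hpair (p q z w : ℕ) : prefixCount (TwoDescents p q) [z, w] m = codeSum m m fun _ => 1 :=
    codeSum_congr fun c hc _ => avoidWeight_beginsWithQuad_of_length_lt (by simp; omega)
  simp only [descentCount, hpair]
  exact sum_Ico_succ_shift (by simp) fun w _ _ => by simp

theorem descentCount_add_two {m : ℕ}
    (hF : ∀ x < m + 2, prefixCount (TwoDescents 1 0) [x + 1] (m + 2) =
      prefixCount (TwoDescents 0 1) [x] (m + 2))
    (hD : ∀ t, descentCount 1 0 m (t + 1) = descentCount 0 1 m t) (t : ℕ) :
    descentCount 1 0 (m + 2) (t + 1) = descentCount 0 1 (m + 2) t := by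
  have h : descentCount 1 0 (m + 2) (t + 1) + ∑ w ∈ Finset.Ico (t + 1) (m + 3),
      ∑ z ∈ Finset.Ico (w + 2) (m + 4), descentCount 1 0 m (z - 1) = _ :=
    descentCount_add 1 0 m (t + 1)
  have h' : descentCount 0 1 (m + 2) t + ∑ w ∈ Finset.Ico t (m + 3),
      ∑ z ∈ Finset.Ico (w + 2) (m + 4), descentCount 0 1 m (z - 1) = _ :=
    descentCount_add 0 1 m t
  have hleft : ∑ w ∈ Finset.Ico (t + 1) (m + 3), ∑ z ∈ Finset.Ico (w + 2) (m + 4),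
        descentCount 1 0 m (z - 1) =
      ∑ w ∈ Finset.Ico t (m + 3), ∑ z ∈ Finset.Ico (w + 2) (m + 4),
        descentCount 0 1 m (z - 1) := by
    refine sum_Ico_succ_shift (by simp) fun w _ _ => ?_
    refine sum_Ico_succ_shift (descentCount_of_lt (by omega)) fun z hz _ => ?_
    obtain ⟨z, rfl⟩ := Nat.exists_eq_add_of_le' hz
    exact hD _
  have hright : ∑ w ∈ Finset.Ico (t + 1) (m + 3), (m + 3 - (w + 0)) *
        prefixCount (TwoDescents 1 0) [w] (m + 2) =
      ∑ w ∈ Finset.Ico t (m + 3), (m + 3 - (w + 1)) *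
        prefixCount (TwoDescents 0 1) [w] (m + 2) :=
    sum_Ico_succ_shift (by simp) fun w _ hw => by rw [hF w hw, Nat.add_zero]
  rw [hleft, hright, ← h'] at h
  exact Nat.add_right_cancel h

theorem avoidCount_twoDescents (n : ℕ) : avoidCount (TwoDescents 1 0) n =
    avoidCount (TwoDescents 0 1) n := by
  suffices h : ∀ m, avoidCount (TwoDescents 1 0) m = avoidCount (TwoDescents 0 1) m ∧
      (∀ x < m, prefixCount (TwoDescents 1 0) [x + 1] m = prefixCount (TwoDescents 0 1) [x] m) ∧
      ∀ t, descentCount 1 0 m (t + 1) = descentCount 0 1 m t from (h n).1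
  intro m
  induction m using Nat.strong_induction_on with
  | _ m ih =>
    have hA : avoidCount (TwoDescents 1 0) m = avoidCount (TwoDescents 0 1) m := by
      rcases m with _ | m
      · exact avoidCount_beginsWithQuad_zero.trans avoidCount_beginsWithQuad_zero.symm
      · exact avoidCount_twoDescents_succ (ih m (by omega)).1 (ih m (by omega)).2.1
    have hF : ∀ x < m, prefixCount (TwoDescents 1 0) [x + 1] m =
        prefixCount (TwoDescents 0 1) [x] m := fun x hx => by
      rcases Nat.lt_or_ge m 3 with hm | hm
      · rw [prefixCount_twoDescents_of_lt hm, prefixCount_twoDescents_of_lt hm]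
      · obtain ⟨m, rfl⟩ := Nat.exists_eq_add_of_le' hm
        exact prefixCount_twoDescents_succ hA (ih m (by omega)).2.2 hx
    refine ⟨hA, hF, fun t => ?_⟩
    rcases Nat.lt_or_ge m 2 with hm | hm
    · exact descentCount_succ_of_lt hm t
    · obtain ⟨m, rfl⟩ := Nat.exists_eq_add_of_le' hm
      exact descentCount_add_two hF (ih m (by omega)).2.2 t

theorem wordCount_31542 (n : ℕ) :
    wordCount [3, 1, 5, 4, 2] n = avoidCount (TwoDescents 1 0) n := by
  refine wordCount_eq_avoidCount_beginsWithQuad (by decide) rfl (fun n x y z w hc => ?_) n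
  have horder (a b c d e : ℕ) : SameOrder [a, b, c, d, e] [3, 1, 5, 4, 2] ↔
      b < e ∧ e < a ∧ a < d ∧ d < c := by
    simp only [sameOrder_cons_cons, List.zip_cons_cons, List.zip_nil_right, List.forall_mem_cons,
      List.not_mem_nil, false_implies, implies_true, sameOrder_nil_nil, Nat.reduceLT, iff_true,
      iff_false, and_true]
    omega
  simp only [WindowOccurrence, decode, List.map_cons, List.map_nil, List.cons_append,
    List.nil_append, horder, lt_skip_iff, skip_lt_skip_iff, skip_lt_iff]
  simp only [IsCode] at hc
  constructor
  · rintro ⟨u, -, hyu, hux, hxw, hwz⟩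
    unfold skip at *
    split_ifs at * <;> omega
  · intro h
    refine ⟨y + 1, ?_⟩
    unfold skip
    split_ifs <;> omega

theorem wordCount_21534 (n : ℕ) :
    wordCount [2, 1, 5, 3, 4] n = avoidCount (TwoDescents 0 1) n := by
  refine wordCount_eq_avoidCount_beginsWithQuad (by decide) rfl (fun n x y z w hc => ?_) n
  have horder (a b c d e : ℕ) : SameOrder [a, b, c, d, e] [2, 1, 5, 3, 4] ↔
      b < a ∧ a < d ∧ d < e ∧ e < c := by
    simp only [sameOrder_cons_cons, List.zip_cons_cons, List.zip_nil_right, List.forall_mem_cons,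
      List.not_mem_nil, false_implies, implies_true, sameOrder_nil_nil, Nat.reduceLT, iff_true,
      iff_false, and_true]
    omega
  simp only [WindowOccurrence, decode, List.map_cons, List.map_nil, List.cons_append,
    List.nil_append, horder, lt_skip_iff, skip_lt_iff]
  simp only [IsCode] at hc
  constructor
  · rintro ⟨u, -, hyx, hxw, hwu, huz⟩
    unfold skip at *
    split_ifs at * <;> omega
  · intro h
    refine ⟨w + 3, ?_⟩
    unfold skip
    split_ifs <;> omega

/-! ### The words `13452`, `12453` and `12354` -/

/-- For `x ≤ m`, the number of codes of length `m` in which `C` does not occur and whose first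
entry, if there is one, is less than `x`. -/
noncomputable def dropCount (C : List ℕ → Prop) : ℕ → ℕ → ℕ
  | 0, _ => 1
  | m + 1, x => ∑ y ∈ Finset.range x, prefixCount C [y] m

/-- If `D m y` and `f m y` count the continuations of length `m` of a weakly increasing run that
ends in `y` when the run stops there and when it goes on in some restricted way, then `ascend D f`
counts those for which the run either stops or makes one more step before that restriction
begins. -/
def ascend (D f : ℕ → ℕ → ℕ) (m y : ℕ) : ℕ := D m y + ∑ z ∈ Finset.Ico y m, f (m - 1) z

/-- The number of continuations of a weakly increasing run that makes any number of steps to its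
last entry `y`, given the numbers `D` of continuations that stop the run. -/
def constantRunCount (D : ℕ → ℕ → ℕ) (m y : ℕ) : ℕ := ∑ k ∈ Finset.Icc y m, D k y

theorem ascend_self (D f : ℕ → ℕ → ℕ) (m : ℕ) : ascend D f m m = D m m := by
  simp [ascend]

theorem ascend_add_ascend {D f g : ℕ → ℕ → ℕ} (hdiag : ∀ m, f m m = D m m)
    (hf : ∀ m y, y ≤ m → f (m + 1) y + g m y = f m y + ascend D g (m + 1) y) {m y : ℕ}
    (hy : y ≤ m) : ascend D f (m + 1) y + ascend D g m y =
      ascend D f m y + ascend D (ascend D g) (m + 1) y := by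
  have hlt : ∑ z ∈ Finset.Ico y m, (f m z + g (m - 1) z) =
      ∑ z ∈ Finset.Ico y m, (f (m - 1) z + ascend D g m z) := by
    refine Finset.sum_congr rfl fun z hz => ?_
    obtain ⟨k, rfl⟩ := Nat.exists_eq_add_of_lt (Finset.mem_Ico.1 hz).2
    exact hf _ z (by omega)
  simp only [Finset.sum_add_distrib] at hlt
  simp only [ascend.eq_1 D f, ascend.eq_1 D (ascend D g), ascend.eq_1 D g m y, Nat.add_sub_cancel,
    Finset.sum_Ico_succ_top hy, hdiag, ascend_self]
  omega

theorem constantRunCount_succ (D : ℕ → ℕ → ℕ) {m y : ℕ} (hy : y ≤ m) :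
    constantRunCount D (m + 1) y = constantRunCount D m y + D (m + 1) y :=
  Finset.sum_Icc_succ_top (by omega) _

theorem constantRunCount_self (D : ℕ → ℕ → ℕ) (m : ℕ) : constantRunCount D m m = D m m := by
  simp [constantRunCount]

theorem ascend_constantRunCount_succ (D : ℕ → ℕ → ℕ) {m y : ℕ} (hy : y ≤ m) :
    ascend D (constantRunCount D) (m + 1) y + D m y =
      ascend D (constantRunCount D) m y + ascend D D (m + 1) y := by
  have h := ascend_add_ascend (g := fun _ _ => 0) (constantRunCount_self D)
    (fun m y hy => by simp [constantRunCount_succ D hy, ascend]) hy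
  simpa [ascend] using h

theorem ascend_ascend_constantRunCount_succ (D : ℕ → ℕ → ℕ) {m y : ℕ} (hy : y ≤ m) :
    ascend D (ascend D (constantRunCount D)) (m + 1) y + ascend D D m y =
      ascend D (ascend D (constantRunCount D)) m y + ascend D (ascend D D) (m + 1) y :=
  ascend_add_ascend (ascend_self _ _) (fun _ _ => ascend_constantRunCount_succ D) hy

theorem prefixCount_cons_of_not {C : List ℕ → Prop} {x : ℕ} {p : List ℕ}
    (h : ∀ c, ¬ C (x :: (p ++ c))) (m : ℕ) : prefixCount C (x :: p) m = prefixCount C p m :=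
  codeSum_congr fun c _ _ => avoidWeight_cons_of_not (h c)

theorem prefixCount_eq_zero {C : List ℕ → Prop} {p : List ℕ} (h : ∀ c, C (p ++ c)) (m : ℕ) :
    prefixCount C p m = 0 :=
  (codeSum_congr fun c _ _ => if_pos ⟨_, List.suffix_rfl, h c⟩).trans (codeSum_zero m m)

section IncreasingQuad

variable {P : ℕ → ℕ → ℕ → ℕ → Prop} (hP : ∀ x y z w, P x y z w → x ≤ y ∧ y ≤ z ∧ z ≤ w)
include hP

theorem avoidWeight_append_of_drop {p : List ℕ} (hp : p.length < 3) {y z : ℕ} (hzy : z < y)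
    (c : List ℕ) : avoidWeight (BeginsWithQuad P) (p ++ y :: z :: c) =
      avoidWeight (BeginsWithQuad P) (z :: c) := by
  have hP' {a b u v : ℕ} (h : P a b u v) := hP _ _ _ _ h
  have h₀ : ¬ BeginsWithQuad P (y :: z :: c) := by
    rcases c with _ | ⟨u, _ | ⟨v, c⟩⟩
    exacts [id, id, fun h => by have := hP' h; omega]
  have h₁ (a : ℕ) : ¬ BeginsWithQuad P (a :: y :: z :: c) := by
    rcases c with _ | ⟨u, c⟩
    exacts [id, fun h => by have := hP' h; omega]
  have h₂ (a b : ℕ) : ¬ BeginsWithQuad P (a :: b :: y :: z :: c) := fun h => by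
    have := hP' h
    omega
  rcases p with _ | ⟨a, _ | ⟨b, _ | ⟨d, p⟩⟩⟩
  · exact avoidWeight_cons_of_not h₀
  · exact (avoidWeight_cons_of_not (h₁ a)).trans (avoidWeight_cons_of_not h₀)
  · exact ((avoidWeight_cons_of_not (h₂ a b)).trans (avoidWeight_cons_of_not (h₁ b))).trans
      (avoidWeight_cons_of_not h₀)
  · simp only [List.length_cons] at hp
    omega

theorem prefixCount_append_singleton {p : List ℕ} (hp : p.length < 3) {m y : ℕ} (hy : y ≤ m) :
    prefixCount (BeginsWithQuad P) (p ++ [y]) m = dropCount (BeginsWithQuad P) m y +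
      ∑ z ∈ Finset.Ico y m, prefixCount (BeginsWithQuad P) (p ++ [y, z]) (m - 1) := by
  rcases m with _ | m
  · obtain rfl := Nat.le_zero.1 hy
    exact avoidWeight_beginsWithQuad_of_length_lt (by simp; omega)
  · have hsplit : prefixCount (BeginsWithQuad P) (p ++ [y]) (m + 1) =
        ∑ z ∈ Finset.range (m + 1), prefixCount (BeginsWithQuad P) (p ++ [y, z]) m := by
      simp only [prefixCount, codeSum, List.append_assoc, List.cons_append, List.nil_append,
        Nat.add_sub_cancel]
    rw [hsplit, ← Finset.sum_range_add_sum_Ico _ hy, dropCount, Nat.add_sub_cancel]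
    refine congrArg (· + _) (Finset.sum_congr rfl fun z hz => codeSum_congr fun c _ _ => ?_)
    simp only [List.append_assoc, List.cons_append, List.nil_append]
    exact avoidWeight_append_of_drop hP hp (Finset.mem_range.1 hz) c

theorem prefixCount_append_singleton_eq_ascend {p : List ℕ} (hp : p.length < 3) {m y : ℕ}
    (hy : y ≤ m) {f : ℕ → ℕ → ℕ} (hf : ∀ k z, y ≤ z → z ≤ k →
      prefixCount (BeginsWithQuad P) (p ++ [y, z]) k = f k z) :
    prefixCount (BeginsWithQuad P) (p ++ [y]) m = ascend (dropCount (BeginsWithQuad P)) f m y := by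
  rw [prefixCount_append_singleton hP hp hy, ascend]
  refine congrArg (_ + ·) (Finset.sum_congr rfl fun z hz => hf _ z (Finset.mem_Ico.1 hz).1 ?_)
  exact Nat.le_sub_one_of_lt (Finset.mem_Ico.1 hz).2

theorem prefixCount_append_singleton_eq_dropCount {p : List ℕ} (hp : p.length < 3) {m y : ℕ}
    (hy : y ≤ m) (h : ∀ z c, y ≤ z → BeginsWithQuad P (p ++ y :: z :: c)) :
    prefixCount (BeginsWithQuad P) (p ++ [y]) m = dropCount (BeginsWithQuad P) m y := by
  rw [prefixCount_append_singleton hP hp hy]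
  refine (congrArg (_ + ·) (Finset.sum_eq_zero fun z hz => ?_)).trans (Nat.add_zero _)
  refine prefixCount_eq_zero (fun c => ?_) _
  rw [List.append_assoc]
  exact h z c (Finset.mem_Ico.1 hz).1

theorem prefixCount_append_singleton_self {p : List ℕ} (hp : p.length < 3) (m : ℕ) :
    prefixCount (BeginsWithQuad P) (p ++ [m]) m = dropCount (BeginsWithQuad P) m m := by
  rw [prefixCount_append_singleton hP hp le_rfl, Finset.Ico_self, Finset.sum_empty, Nat.add_zero]

end IncreasingQuad

/-- The numbers of codes with given first entry in which `C` does not occur are those of the codes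
whose weakly increasing runs make at most two strict steps, all at their beginning. -/
def HasRunCounts (C : List ℕ → Prop) : Prop :=
  ∀ m x, x ≤ m → prefixCount C [x] m =
    ascend (dropCount C) (ascend (dropCount C) (constantRunCount (dropCount C))) m x

theorem dropCount_congr {C C' : List ℕ → Prop} {m : ℕ}
    (h : ∀ k < m, ∀ x ≤ k, prefixCount C [x] k = prefixCount C' [x] k) {x : ℕ} (hx : x ≤ m) :
    dropCount C m x = dropCount C' m x := by
  rcases m with _ | m
  · rfl
  · refine Finset.sum_congr rfl fun y hy => h m (Nat.lt_succ_self m) y ?_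
    have := Finset.mem_range.1 hy
    omega

theorem ascend_congr {D D' f f' : ℕ → ℕ → ℕ} {m : ℕ} (hD : ∀ k ≤ m, ∀ y ≤ k, D k y = D' k y)
    (hf : ∀ k ≤ m, ∀ y ≤ k, f k y = f' k y) : ∀ k ≤ m, ∀ y ≤ k, ascend D f k y = ascend D' f' k y :=
  fun k hk y hy => congrArg₂ (· + ·) (hD k hk y hy) <| Finset.sum_congr rfl fun z hz =>
    hf _ (by omega) z (Nat.le_sub_one_of_lt (Finset.mem_Ico.1 hz).2)

theorem HasRunCounts.avoidCount_eq {C C' : List ℕ → Prop} (h : HasRunCounts C)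
    (h' : HasRunCounts C') (h₀ : avoidCount C 0 = avoidCount C' 0) (n : ℕ) :
    avoidCount C n = avoidCount C' n := by
  refine avoidCount_eq_of_prefixCount_eq (fun m => ?_) h₀ n
  induction m using Nat.strong_induction_on with
  | _ m ih =>
    intro x hx
    have hD : ∀ k ≤ m, ∀ y ≤ k, dropCount C k y = dropCount C' k y := fun k hk y hy =>
      dropCount_congr (fun i hi => ih i (by omega)) hy
    rw [h m x hx, h' m x hx]
    refine ascend_congr hD (ascend_congr hD fun k hk y _ => ?_) m le_rfl x hx
    refine Finset.sum_congr rfl fun i hi => hD i ?_ y (Finset.mem_Icc.1 hi).1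
    exact (Finset.mem_Icc.1 hi).2.trans hk

theorem hasRunCounts_strict_last :
    HasRunCounts (BeginsWithQuad fun x y z w => x ≤ y ∧ y ≤ z ∧ z < w) := by
  set P : ℕ → ℕ → ℕ → ℕ → Prop := fun x y z w => x ≤ y ∧ y ≤ z ∧ z < w
  have hP (x y z w : ℕ) (h : P x y z w) : x ≤ y ∧ y ≤ z ∧ z ≤ w := ⟨h.1, h.2.1, h.2.2.le⟩
  have hthree (m x y z : ℕ) (hxy : x ≤ y) (hyz : y ≤ z) (hz : z ≤ m) :
      prefixCount (BeginsWithQuad P) [x, y, z] m =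
        constantRunCount (dropCount (BeginsWithQuad P)) m z := by
    induction m, hz using Nat.le_induction generalizing x y with
    | base =>
      exact (prefixCount_append_singleton_self hP (p := [x, y]) (by simp) _).trans
        (constantRunCount_self _ _).symm
    | succ m hz ih =>
      have hstep : prefixCount (BeginsWithQuad P) [x, y, z, z] m =
          constantRunCount (dropCount (BeginsWithQuad P)) m z :=
        (prefixCount_cons_of_not (fun c h => lt_irrefl z h.2.2) m).trans (ih y z hyz le_rfl)
      have hzero (w : ℕ) (hw : w ∈ Finset.Ico (z + 1) (m + 1)) :
          prefixCount (BeginsWithQuad P) [x, y, z, w] m = 0 :=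
        prefixCount_eq_zero (fun _ => ⟨hxy, hyz, (Finset.mem_Ico.1 hw).1⟩) m
      refine (prefixCount_append_singleton hP (p := [x, y]) (by simp) (by omega)).trans ?_
      rw [constantRunCount_succ _ hz, Finset.sum_eq_sum_Ico_succ_bot (by omega), Nat.add_comm]
      simp only [List.cons_append, List.nil_append, Nat.add_sub_cancel, hstep,
        Finset.sum_eq_zero hzero, Nat.add_zero]
  exact fun m x hx => prefixCount_append_singleton_eq_ascend hP (p := []) (by simp) hx
    fun k y hxy hy => prefixCount_append_singleton_eq_ascend hP (p := [x]) (by simp) hy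
      fun l z hyz hz => hthree l x y z hxy hyz hz

theorem hasRunCounts_strict_middle :
    HasRunCounts (BeginsWithQuad fun x y z w => x ≤ y ∧ y < z ∧ z ≤ w) := by
  set P : ℕ → ℕ → ℕ → ℕ → Prop := fun x y z w => x ≤ y ∧ y < z ∧ z ≤ w
  have hP (x y z w : ℕ) (h : P x y z w) : x ≤ y ∧ y ≤ z ∧ z ≤ w := ⟨h.1, h.2.1.le, h.2.2⟩
  set D := dropCount (BeginsWithQuad P) with hD
  have htwo (m x y : ℕ) (hxy : x ≤ y) (hy : y ≤ m) :
      prefixCount (BeginsWithQuad P) [x, y] m = ascend D (constantRunCount D) m y := by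
    induction m, hy using Nat.le_induction generalizing x with
    | base =>
      exact (prefixCount_append_singleton_self hP (p := [x]) (by simp) _).trans
        (ascend_self _ _ _).symm
    | succ m hy ih =>
      have hconst : prefixCount (BeginsWithQuad P) [x, y, y] m =
          ascend D (constantRunCount D) m y :=
        (prefixCount_cons_of_not (by rintro (_ | ⟨w, c⟩) h; exacts [h, lt_irrefl y h.2.1]) m).trans
          (ih y le_rfl)
      have hstep (z : ℕ) (hz : z ∈ Finset.Ico (y + 1) (m + 1)) :
          prefixCount (BeginsWithQuad P) [x, y, z] m = D m z := by
        have hz := Finset.mem_Ico.1 hz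
        exact prefixCount_append_singleton_eq_dropCount hP (p := [x, y]) (by simp) (by omega)
          fun w _ hw => ⟨hxy, hz.1, hw⟩
      have hsplit : prefixCount (BeginsWithQuad P) [x, y] (m + 1) = D (m + 1) y +
          (ascend D (constantRunCount D) m y + ∑ z ∈ Finset.Ico (y + 1) (m + 1), D m z) := by
        refine (prefixCount_append_singleton hP (p := [x]) (by simp) (by omega)).trans ?_
        rw [Finset.sum_eq_sum_Ico_succ_bot (by omega)]
        simp only [List.cons_append, List.nil_append, Nat.add_sub_cancel, hconst,
          Finset.sum_congr rfl hstep, hD]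
      have hrec := ascend_constantRunCount_succ D hy
      rw [ascend.eq_1 D D, Finset.sum_eq_sum_Ico_succ_bot (by omega), Nat.add_sub_cancel] at hrec
      omega
  exact fun m x hx => prefixCount_append_singleton_eq_ascend hP (p := []) (by simp) hx
    fun k y hxy hy => htwo k x y hxy hy

theorem hasRunCounts_strict_first :
    HasRunCounts (BeginsWithQuad fun x y z w => x < y ∧ y ≤ z ∧ z ≤ w) := by
  set P : ℕ → ℕ → ℕ → ℕ → Prop := fun x y z w => x < y ∧ y ≤ z ∧ z ≤ w
  have hP (x y z w : ℕ) (h : P x y z w) : x ≤ y ∧ y ≤ z ∧ z ≤ w := ⟨h.1.le, h.2.1, h.2.2⟩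
  set D := dropCount (BeginsWithQuad P) with hD
  have hone (m x : ℕ) (hx : x ≤ m) : prefixCount (BeginsWithQuad P) [x] m =
      ascend D (ascend D (constantRunCount D)) m x := by
    induction m, hx using Nat.le_induction with
    | base =>
      exact (prefixCount_append_singleton_self hP (p := []) (by simp) _).trans
        (ascend_self _ _ _).symm
    | succ m hx ih =>
      have hconst : prefixCount (BeginsWithQuad P) [x, x] m =
          ascend D (ascend D (constantRunCount D)) m x :=
        (prefixCount_cons_of_not (by
          rintro (_ | ⟨z, _ | ⟨w, c⟩⟩) h; exacts [h, h, lt_irrefl x h.1]) m).trans ih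
      have hstep (y : ℕ) (hy : y ∈ Finset.Ico (x + 1) (m + 1)) :
          prefixCount (BeginsWithQuad P) [x, y] m = ascend D D m y := by
        have hy := Finset.mem_Ico.1 hy
        exact prefixCount_append_singleton_eq_ascend hP (p := [x]) (by simp) (by omega)
          fun k z hyz hz => prefixCount_append_singleton_eq_dropCount hP (p := [x, y]) (by simp) hz
            fun w _ hw => ⟨hy.1, hyz, hw⟩
      have hsplit : prefixCount (BeginsWithQuad P) [x] (m + 1) = D (m + 1) x +
          (ascend D (ascend D (constantRunCount D)) m x +
            ∑ y ∈ Finset.Ico (x + 1) (m + 1), ascend D D m y) := by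
        refine (prefixCount_append_singleton hP (p := []) (by simp) (by omega)).trans ?_
        rw [Finset.sum_eq_sum_Ico_succ_bot (by omega)]
        simp only [List.nil_append, Nat.add_sub_cancel, hconst, Finset.sum_congr rfl hstep, hD]
      have hrec := ascend_ascend_constantRunCount_succ D hx
      rw [ascend.eq_1 D (ascend D D), Finset.sum_eq_sum_Ico_succ_bot (by omega), Nat.add_sub_cancel]
        at hrec
      omega
  exact hone

theorem wordCount_13452 (n : ℕ) : wordCount [1, 3, 4, 5, 2] n =
    avoidCount (BeginsWithQuad fun x y z w => x < y ∧ y ≤ z ∧ z ≤ w) n := by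
  refine wordCount_eq_avoidCount_beginsWithQuad (by decide) rfl (fun n x y z w hc => ?_) n
  have horder (a b c d e : ℕ) : SameOrder [a, b, c, d, e] [1, 3, 4, 5, 2] ↔
      a < e ∧ e < b ∧ b < c ∧ c < d := by
    simp only [sameOrder_cons_cons, List.zip_cons_cons, List.zip_nil_right, List.forall_mem_cons,
      List.not_mem_nil, false_implies, implies_true, sameOrder_nil_nil, Nat.reduceLT, iff_true,
      iff_false, and_true]
    omega
  simp only [WindowOccurrence, decode, List.map_cons, List.map_nil, List.cons_append,
    List.nil_append, horder, lt_skip_iff, skip_lt_skip_iff]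
  simp only [IsCode] at hc
  constructor
  · rintro ⟨u, -, hxu, huy, hyz, hzw⟩
    unfold skip at huy
    split_ifs at huy <;> omega
  · intro h
    refine ⟨x + 1, ?_⟩
    unfold skip
    split_ifs <;> omega

theorem wordCount_12453 (n : ℕ) : wordCount [1, 2, 4, 5, 3] n =
    avoidCount (BeginsWithQuad fun x y z w => x ≤ y ∧ y < z ∧ z ≤ w) n := by
  refine wordCount_eq_avoidCount_beginsWithQuad (by decide) rfl (fun n x y z w hc => ?_) n
  have horder (a b c d e : ℕ) : SameOrder [a, b, c, d, e] [1, 2, 4, 5, 3] ↔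
      a < b ∧ b < e ∧ e < c ∧ c < d := by
    simp only [sameOrder_cons_cons, List.zip_cons_cons, List.zip_nil_right, List.forall_mem_cons,
      List.not_mem_nil, false_implies, implies_true, sameOrder_nil_nil, Nat.reduceLT, iff_true,
      iff_false, and_true]
    omega
  simp only [WindowOccurrence, decode, List.map_cons, List.map_nil, List.cons_append,
    List.nil_append, horder, lt_skip_iff, skip_lt_skip_iff]
  simp only [IsCode] at hc
  constructor
  · rintro ⟨u, -, hxy, hyu, huz, hzw⟩
    unfold skip at hyu huz
    split_ifs at hyu huz <;> omega
  · intro h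
    refine ⟨y + 2, ?_⟩
    unfold skip
    split_ifs <;> omega

theorem wordCount_12354 (n : ℕ) : wordCount [1, 2, 3, 5, 4] n =
    avoidCount (BeginsWithQuad fun x y z w => x ≤ y ∧ y ≤ z ∧ z < w) n := by
  refine wordCount_eq_avoidCount_beginsWithQuad (by decide) rfl (fun n x y z w hc => ?_) n
  have horder (a b c d e : ℕ) : SameOrder [a, b, c, d, e] [1, 2, 3, 5, 4] ↔
      a < b ∧ b < c ∧ c < e ∧ e < d := by
    simp only [sameOrder_cons_cons, List.zip_cons_cons, List.zip_nil_right, List.forall_mem_cons,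
      List.not_mem_nil, false_implies, implies_true, sameOrder_nil_nil, Nat.reduceLT, iff_true,
      iff_false, and_true]
    omega
  simp only [WindowOccurrence, decode, List.map_cons, List.map_nil, List.cons_append,
    List.nil_append, horder, lt_skip_iff, skip_lt_skip_iff]
  simp only [IsCode] at hc
  constructor
  · rintro ⟨u, -, hxy, hyz, hzu, huw⟩
    unfold skip at hzu huw
    split_ifs at hzu huw <;> omega
  · intro h
    refine ⟨z + 3, ?_⟩
    unfold skip
    split_ifs <;> omega

/-! ### Evaluation by dynamic programming -/

/-- The least value that exceeds the entries of `l` at the positions of the letters of `σ` below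
`a`. If any value extends an occurrence `l` of `σ` to one of `σ ++ [a]`, then this one does. -/
def leastExtension (l σ : List ℕ) (a : ℕ) : ℕ :=
  (l.zip σ).foldr (fun p m => bif p.2.blt a then max (p.1 + 1) m else m) 0

/-- Whether the value `u` extends an occurrence `l` of `σ` to one of `σ ++ [a]`. -/
def isExtension (l σ : List ℕ) (a u : ℕ) : Bool :=
  (leastExtension l σ a).ble u && (l.zip σ).all fun p => bif a.blt p.2 then u.blt p.1 else true

/-- Whether some value `u < n` extends an occurrence `l` of `σ` to one of `σ ++ [a]`. -/
def hasExtension (n : ℕ) (l σ : List ℕ) (a : ℕ) : Bool :=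
  (leastExtension l σ a).blt n && isExtension l σ a (leastExtension l σ a)

theorem cond_blt_eq_true_iff {a b : ℕ} {p : Bool} :
    (bif a.blt b then p else true) = true ↔ (a < b → p = true) := by
  rw [← Nat.blt_eq]
  cases a.blt b <;> simp

theorem leastExtension_le_iff {l σ : List ℕ} {a u : ℕ} :
    leastExtension l σ a ≤ u ↔ ∀ p ∈ l.zip σ, p.2 < a → p.1 < u := by
  unfold leastExtension
  induction l.zip σ with
  | nil => simp
  | cons p L ih =>
    rw [List.foldr_cons, List.forall_mem_cons, ← ih, ← Nat.blt_eq]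
    cases p.2.blt a <;> simp

theorem isExtension_iff {l σ : List ℕ} {a u : ℕ} :
    isExtension l σ a u = true ↔ ∀ p ∈ l.zip σ, (p.2 < a → p.1 < u) ∧ (a < p.2 → u < p.1) := by
  simp only [isExtension, Bool.and_eq_true, Nat.ble_eq, leastExtension_le_iff, List.all_eq_true,
    forall_and, cond_blt_eq_true_iff, Nat.blt_eq]

theorem hasExtension_iff {n : ℕ} {l σ : List ℕ} {a : ℕ} :
    hasExtension n l σ a = true ↔ ∃ u < n, isExtension l σ a u = true := by
  rw [hasExtension, Bool.and_eq_true, Nat.blt_eq]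
  refine ⟨fun h => ⟨_, h⟩, fun ⟨u, hu, h⟩ => ?_⟩
  rw [isExtension_iff, forall₂_and] at h
  have hle := leastExtension_le_iff.2 h.1
  refine ⟨hle.trans_lt hu, isExtension_iff.2 (forall₂_and.2 ⟨leastExtension_le_iff.1 le_rfl, ?_⟩)⟩
  exact fun p hp hap => hle.trans_lt (h.2 p hp hap)

theorem sameOrder_decode_append_singleton_iff {p σ : List ℕ} {y a : ℕ} (ha : a ∉ σ) :
    SameOrder (decode (p ++ [y])) (σ ++ [a]) ↔
      SameOrder (decode p) σ ∧ isExtension (decode p) σ a (relabel p y) = true := by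
  rw [decode_append, isExtension_iff, ← sameOrder_append_singleton_iff ha]
  rfl

theorem windowOccurrence_append_singleton_iff {σ c : List ℕ} {n e : ℕ} (he : e ∉ σ) :
    WindowOccurrence (σ ++ [e]) n c ↔
      SameOrder (decode c) σ ∧ hasExtension n (decode c) σ e = true := by
  simp only [WindowOccurrence, sameOrder_append_singleton_iff he, ← isExtension_iff,
    hasExtension_iff]
  tauto

/-- Whether codes with beginning `x, y, z` begin with an occurrence of the consecutive word
`abc`. -/
def beginsWithTriple (a b c x y z : ℕ) : Bool :=
  isExtension [x] [a] b (relabel [x] y) && isExtension (decode [x, y]) [a, b] c (relabel [x, y] z)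

/-- Whether codes of length `n` with beginning `x, y, z, u`, that begin with an occurrence of `abc`,
begin with an occurrence of `abcd-e`. -/
def completesTriple (a b c d e n x y z u : ℕ) : Bool :=
  isExtension (decode [x, y, z]) [a, b, c] d (relabel [x, y, z] u) &&
    hasExtension n (decode [x, y, z, u]) [a, b, c, d] e

theorem windowOccurrence_iff_completesTriple {a b c d e n x y z u : ℕ}
    (hw : [a, b, c, d, e].Nodup) : WindowOccurrence [a, b, c, d, e] n [x, y, z, u] ↔
      beginsWithTriple a b c x y z = true ∧ completesTriple a b c d e n x y z u = true := by
  obtain ⟨he, hd, hc, hb⟩ : e ∉ [a, b, c, d] ∧ d ∉ [a, b, c] ∧ c ∉ [a, b] ∧ b ∉ [a] := by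
    simp only [List.nodup_cons, List.mem_cons, List.not_mem_nil] at hw ⊢
    tauto
  have hx : SameOrder (decode [x]) [a] := ⟨rfl, List.pairwise_singleton _ _⟩
  have h₄ := windowOccurrence_append_singleton_iff (c := [x, y, z, u]) (n := n) he
  have h₃ := sameOrder_decode_append_singleton_iff (p := [x, y, z]) (y := u) hd
  have h₂ := sameOrder_decode_append_singleton_iff (p := [x, y]) (y := z) hc
  have h₁ := sameOrder_decode_append_singleton_iff (p := [x]) (y := y) hb
  simp only [List.cons_append, List.nil_append] at h₁ h₂ h₃ h₄
  rw [h₄, h₃, h₂, h₁, and_iff_right hx, beginsWithTriple, completesTriple, Bool.and_eq_true,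
    Bool.and_eq_true, and_assoc, and_assoc, and_assoc]
  rfl

open Classical in
theorem prefixCount_cons {w p : List ℕ} (hp : p.length + 2 = w.length) (x m : ℕ) :
    prefixCount (CodeOccurrence w) (x :: p) m =
      if WindowOccurrence w (m + p.length + 1) (x :: p) then 0
        else prefixCount (CodeOccurrence w) p m := by
  have hcons {c : List ℕ} (hc : c.length = m) :
      CodeOccurrence w (x :: (p ++ c)) ↔ WindowOccurrence w (m + p.length + 1) (x :: p) := by
    rw [CodeOccurrence, ← hp, ← List.cons_append, List.take_left' (by simp)]
    simp only [List.length_append, List.length_cons, hc]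
    rw [add_comm, add_assoc]
  rw [prefixCount, codeSum_congr fun c hc _ => by
    rw [List.cons_append, avoidWeight_cons, if_congr (hcons hc) rfl rfl]]
  split_ifs
  · exact codeSum_zero m m
  · rfl

/-- The sum of the entries of `l` at the positions `u` where codes of length `n` with beginning
`x, y, z, u` do not begin with an occurrence of `abcd-e`. -/
def sumAvoiding (a b c d e n x y z : ℕ) (l : List ℕ) : ℕ :=
  bif beginsWithTriple a b c x y z then
    ((List.range (n - 3)).zipWith
      (fun u t => bif completesTriple a b c d e n x y z u then 0 else t) l).sum
  else l.sum

/-- The numbers of codes of length `k + 3` that avoid `abcd-e`, by their first three entries. -/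
def countTable (a b c d e : ℕ) : ℕ → List (List (List ℕ))
  | 0 => [[[1], [1]], [[1], [1]], [[1], [1]]]
  | k + 1 => (List.range (k + 4)).map fun x => (List.range (k + 3)).zipWith (fun y =>
      (List.range (k + 2)).zipWith fun z => sumAvoiding a b c d e (k + 4) x y z)
        (countTable a b c d e k)

theorem sum_map_range (g : ℕ → ℕ) (n : ℕ) :
    ((List.range n).map g).sum = ∑ i ∈ Finset.range n, g i := rfl

theorem zipWith_range_map_range {α β : Type*} (f : ℕ → α → β) (g : ℕ → α) (n : ℕ) :
    (List.range n).zipWith f ((List.range n).map g) = (List.range n).map fun i => f i (g i) := by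
  rw [List.zipWith_map_right, List.zipWith_self]

theorem sumAvoiding_eq_prefixCount {a b c d e : ℕ} (hw : [a, b, c, d, e].Nodup) (k x y z : ℕ) :
    sumAvoiding a b c d e (k + 4) x y z ((List.range (k + 1)).map fun u =>
      prefixCount (CodeOccurrence [a, b, c, d, e]) [y, z, u] k) =
        prefixCount (CodeOccurrence [a, b, c, d, e]) [x, y, z] (k + 1) := by
  have hcons (u : ℕ) : prefixCount (CodeOccurrence [a, b, c, d, e]) [x, y, z, u] k =
      if beginsWithTriple a b c x y z = true ∧ completesTriple a b c d e (k + 4) x y z u = true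
        then 0 else prefixCount (CodeOccurrence [a, b, c, d, e]) [y, z, u] k := by
    rw [prefixCount_cons (p := [y, z, u]) rfl]
    exact if_congr (windowOccurrence_iff_completesTriple hw) rfl rfl
  have hsucc : prefixCount (CodeOccurrence [a, b, c, d, e]) [x, y, z] (k + 1) =
      ∑ u ∈ Finset.range (k + 1), prefixCount (CodeOccurrence [a, b, c, d, e]) [x, y, z, u] k := rfl
  rw [hsucc, sumAvoiding, show k + 4 - 3 = k + 1 from rfl, zipWith_range_map_range, sum_map_range,
    sum_map_range]
  simp only [hcons]
  cases beginsWithTriple a b c x y z <;> simp [Bool.cond_eq_ite]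

theorem countTable_eq {a b c d e : ℕ} (hw : [a, b, c, d, e].Nodup) (k : ℕ) :
    countTable a b c d e k = (List.range (k + 3)).map fun x => (List.range (k + 2)).map fun y =>
      (List.range (k + 1)).map fun z =>
        prefixCount (CodeOccurrence [a, b, c, d, e]) [x, y, z] k := by
  induction k with
  | zero =>
    have h (x y z : ℕ) : prefixCount (CodeOccurrence [a, b, c, d, e]) [x, y, z] 0 = 1 :=
      avoidWeight_of_length_lt (by simp)
    simp only [h]
    rfl
  | succ k ih =>
    simp only [countTable, ih, zipWith_range_map_range, sumAvoiding_eq_prefixCount hw]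

theorem wordCount_eq_sum_countTable {a b c d e : ℕ} (hw : [a, b, c, d, e].Nodup) (k : ℕ) :
    wordCount [a, b, c, d, e] (k + 3) =
      ((countTable a b c d e k).map fun l => (l.map List.sum).sum).sum := by
  rw [countTable_eq hw, wordCount_eq_avoidCount hw]
  simp only [List.map_map, Function.comp_def, sum_map_range]
  rfl

/-- The number of permutations of ten letters that avoid a pattern, by dynamic programming. -/
def wordCountTen (l : List ℕ) : ℕ :=
  match l with
  | [a, b, c, d, e] => ((countTable a b c d e 7).map fun l => (l.map List.sum).sum).sum
  | _ => 0


/-! ### The rows of the table -/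

section Rows

variable (n : ℕ)

theorem wordCount_swap_five {a b c d e : ℕ} (h : [a, b, c, d, e].Nodup ∧
    IsNonOverlapping [a, b, c, d] ∧ IsNonOverlapping [a, c, b, d]) :
    wordCount [a, b, c, d, e] n = wordCount [a, c, b, d, e] n :=
  wordCount_swap h.1 (by simp) h.2.1 h.2.2 n

theorem wordCount_exchange_second_five {a t c d : ℕ} (h : [t, t + 1, a, c, d].Nodup ∧
    IsNonOverlapping [a, t, c, d] ∧ IsNonOverlapping [a, t + 1, c, d]) :
    wordCount [a, t, c, d, t + 1] n = wordCount [a, t + 1, c, d, t] n :=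
  wordCount_exchange (σ := [a]) (τ := [c, d]) h.1 (by simp) (by simp) h.2.1 h.2.2 n

theorem wordCount_exchange_third_five {a b t d : ℕ} (h : [t, t + 1, a, b, d].Nodup ∧
    IsNonOverlapping [a, b, t, d] ∧ IsNonOverlapping [a, b, t + 1, d]) :
    wordCount [a, b, t, d, t + 1] n = wordCount [a, b, t + 1, d, t] n :=
  wordCount_exchange (σ := [a, b]) (τ := [d]) h.1 (by simp) (by simp) h.2.1 h.2.2 n

theorem wordCount_rowF : ∀ w ∈ [[1, 2, 5, 3, 4], [2, 1, 3, 4, 5], [2, 3, 5, 4, 1],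
    [3, 1, 4, 5, 2], [3, 2, 4, 5, 1]], wordCount w n = wordCount [1, 2, 4, 3, 5] n := by
  have h12534 : wordCount [1, 2, 4, 3, 5] n = wordCount [1, 2, 5, 3, 4] n :=
    wordCount_exchange_third_five n (by decide)
  have h43125 : wordCount [4, 3, 1, 2, 5] n = wordCount [1, 2, 4, 3, 5] n :=
    wordCount_map_sub_append_singleton (σ := [1, 2, 4, 3]) (by decide) n
  have h21345 : wordCount [2, 1, 3, 4, 5] n = wordCount [4, 3, 1, 2, 5] n :=
    wordCount_reverse_append_singleton (σ := [4, 3, 1, 2]) (by decide) n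
  have h23541 : wordCount [1, 2, 4, 3, 5] n = wordCount [2, 3, 5, 4, 1] n :=
    wordCount_largest_eq_smallest (σ := [1, 2, 4, 3]) (τ := [2, 3, 5, 4])
      (by decide) (by decide) (by decide) n
  have h32451 : wordCount [2, 1, 3, 4, 5] n = wordCount [3, 2, 4, 5, 1] n :=
    wordCount_largest_eq_smallest (σ := [2, 1, 3, 4]) (τ := [3, 2, 4, 5])
      (by decide) (by decide) (by decide) n
  have h31452 : wordCount [3, 1, 4, 5, 2] n = wordCount [3, 2, 4, 5, 1] n :=
    wordCount_exchange_second_five n (by decide)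
  simp only [List.forall_mem_cons, List.not_mem_nil, false_implies, implies_true, and_true]
  omega

/-- Replacing the letters before the dash by their reversal and complement leaves two groups of
words; the swap of `3` and `4` in `1342-5` merges them. -/
theorem wordCount_rowL_largest : ∀ w ∈ [[3, 2, 1, 4, 5], [2, 3, 4, 1, 5], [2, 4, 3, 1, 5],
    [1, 3, 4, 2, 5], [1, 4, 3, 2, 5]], wordCount w n = wordCount [3, 1, 2, 4, 5] n := by
  have h31245 : wordCount [3, 1, 2, 4, 5] n = wordCount [2, 4, 3, 1, 5] n :=
    wordCount_map_sub_append_singleton (σ := [2, 4, 3, 1]) (by decide) n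
  have h24315 : wordCount [2, 4, 3, 1, 5] n = wordCount [1, 3, 4, 2, 5] n :=
    wordCount_reverse_append_singleton (σ := [1, 3, 4, 2]) (by decide) n
  have h32145 : wordCount [3, 2, 1, 4, 5] n = wordCount [2, 3, 4, 1, 5] n :=
    wordCount_map_sub_append_singleton (σ := [2, 3, 4, 1]) (by decide) n
  have h23415 : wordCount [2, 3, 4, 1, 5] n = wordCount [1, 4, 3, 2, 5] n :=
    wordCount_reverse_append_singleton (σ := [1, 4, 3, 2]) (by decide) n
  have h13425 : wordCount [1, 3, 4, 2, 5] n = wordCount [1, 4, 3, 2, 5] n :=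
    wordCount_swap_five n (by decide)
  simp only [List.forall_mem_cons, List.not_mem_nil, false_implies, implies_true, and_true]
  omega

theorem wordCount_rowL : ∀ w ∈ [[3, 2, 1, 4, 5], [2, 5, 4, 3, 1], [2, 4, 5, 3, 1],
    [2, 3, 4, 1, 5], [2, 4, 3, 1, 5], [1, 3, 4, 2, 5], [1, 4, 3, 2, 5], [1, 3, 5, 2, 4],
    [1, 4, 5, 2, 3], [1, 5, 3, 2, 4], [1, 5, 4, 2, 3], [2, 5, 3, 1, 4], [2, 5, 4, 1, 3],
    [2, 3, 5, 1, 4], [2, 4, 5, 1, 3]], wordCount w n = wordCount [3, 1, 2, 4, 5] n := by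
  have hlargest := wordCount_rowL_largest n
  have h25431 : wordCount [1, 4, 3, 2, 5] n = wordCount [2, 5, 4, 3, 1] n :=
    wordCount_largest_eq_smallest (σ := [1, 4, 3, 2]) (τ := [2, 5, 4, 3])
      (by decide) (by decide) (by decide) n
  have h24531 : wordCount [1, 3, 4, 2, 5] n = wordCount [2, 4, 5, 3, 1] n :=
    wordCount_largest_eq_smallest (σ := [1, 3, 4, 2]) (τ := [2, 4, 5, 3])
      (by decide) (by decide) (by decide) n
  have h13524 : wordCount [1, 3, 4, 2, 5] n = wordCount [1, 3, 5, 2, 4] n :=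
    wordCount_exchange_third_five n (by decide)
  have h14523 : wordCount [1, 3, 5, 2, 4] n = wordCount [1, 4, 5, 2, 3] n :=
    wordCount_exchange_second_five n (by decide)
  have h15324 : wordCount [1, 3, 5, 2, 4] n = wordCount [1, 5, 3, 2, 4] n :=
    wordCount_swap_five n (by decide)
  have h15423 : wordCount [1, 4, 5, 2, 3] n = wordCount [1, 5, 4, 2, 3] n :=
    wordCount_swap_five n (by decide)
  have h23514 : wordCount [2, 3, 4, 1, 5] n = wordCount [2, 3, 5, 1, 4] n :=
    wordCount_exchange_third_five n (by decide)
  have h24513 : wordCount [2, 3, 5, 1, 4] n = wordCount [2, 4, 5, 1, 3] n :=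
    wordCount_exchange_second_five n (by decide)
  have h25314 : wordCount [2, 3, 5, 1, 4] n = wordCount [2, 5, 3, 1, 4] n :=
    wordCount_swap_five n (by decide)
  have h25413 : wordCount [2, 4, 5, 1, 3] n = wordCount [2, 5, 4, 1, 3] n :=
    wordCount_swap_five n (by decide)
  simp only [List.forall_mem_cons, List.not_mem_nil, false_implies, implies_true, and_true]
    at hlargest ⊢
  omega

theorem wordCount_rowR : ∀ w ∈ [[2, 3, 1, 4, 5], [2, 5, 3, 4, 1], [3, 2, 4, 1, 5]],
    wordCount w n = wordCount [1, 4, 2, 3, 5] n := by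
  have h41325 : wordCount [4, 1, 3, 2, 5] n = wordCount [1, 4, 2, 3, 5] n :=
    wordCount_map_sub_append_singleton (σ := [1, 4, 2, 3]) (by decide) n
  have h23145 : wordCount [2, 3, 1, 4, 5] n = wordCount [4, 1, 3, 2, 5] n :=
    wordCount_reverse_append_singleton (σ := [4, 1, 3, 2]) (by decide) n
  have h25341 : wordCount [1, 4, 2, 3, 5] n = wordCount [2, 5, 3, 4, 1] n :=
    wordCount_largest_eq_smallest (σ := [1, 4, 2, 3]) (τ := [2, 5, 3, 4])
      (by decide) (by decide) (by decide) n
  have h32415 : wordCount [3, 2, 4, 1, 5] n = wordCount [1, 4, 2, 3, 5] n :=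
    wordCount_reverse_append_singleton (σ := [1, 4, 2, 3]) (by decide) n
  simp only [List.forall_mem_cons, List.not_mem_nil, false_implies, implies_true, and_true]
  omega

theorem wordCount_rowY : ∀ w ∈ [[1, 2, 4, 5, 3], [1, 3, 4, 5, 2]],
    wordCount w n = wordCount [1, 2, 3, 5, 4] n := by
  simp only [List.forall_mem_cons, List.not_mem_nil, false_implies, implies_true, and_true]
  rw [wordCount_12354, wordCount_12453, wordCount_13452]
  have h₀ {P Q : ℕ → ℕ → ℕ → ℕ → Prop} :
      avoidCount (BeginsWithQuad P) 0 = avoidCount (BeginsWithQuad Q) 0 :=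
    avoidCount_beginsWithQuad_zero.trans avoidCount_beginsWithQuad_zero.symm
  exact ⟨hasRunCounts_strict_middle.avoidCount_eq hasRunCounts_strict_last h₀ n,
    hasRunCounts_strict_first.avoidCount_eq hasRunCounts_strict_last h₀ n⟩

end Rows

theorem wordCount_eq_headD (n : ℕ) :
    ∀ row ∈ classTable, ∀ l ∈ row, wordCount l n = wordCount (row.headD []) n := by
  have hA : wordCount [1, 3, 5, 4, 2] n = wordCount [1, 2, 5, 4, 3] n :=
    .symm <| wordCount_exchange_second_five n (by decide)
  have hB : wordCount [1, 5, 4, 3, 2] n = wordCount [1, 4, 5, 3, 2] n :=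
    .symm <| wordCount_swap_five n (by decide)
  have hC : wordCount [2, 1, 4, 5, 3] n = wordCount [2, 1, 3, 5, 4] n :=
    .symm <| wordCount_exchange_third_five n (by decide)
  have hG : wordCount [3, 2, 1, 5, 4] n = wordCount [3, 1, 2, 5, 4] n :=
    .symm <| wordCount_swap_five n (by decide)
  have hM : wordCount [3, 1, 5, 4, 2] n = wordCount [2, 1, 5, 3, 4] n := by
    rw [wordCount_31542, wordCount_21534, avoidCount_twoDescents]
  have hS : wordCount [3, 2, 5, 4, 1] n = wordCount [2, 1, 4, 3, 5] n :=
    .symm <| wordCount_largest_eq_smallest (σ := [2, 1, 4, 3]) (τ := [3, 2, 5, 4])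
      (by decide) (by decide) (by decide) n
  have hV : wordCount [2, 4, 3, 5, 1] n = wordCount [1, 3, 2, 4, 5] n :=
    .symm <| wordCount_largest_eq_smallest (σ := [1, 3, 2, 4]) (τ := [2, 4, 3, 5])
      (by decide) (by decide) (by decide) n
  have hX : wordCount [3, 1, 4, 2, 5] n = wordCount [2, 4, 1, 3, 5] n :=
    wordCount_reverse_append_singleton (σ := [2, 4, 1, 3]) (by decide) n
  have hZ : wordCount [2, 3, 4, 5, 1] n = wordCount [1, 2, 3, 4, 5] n :=
    .symm <| wordCount_largest_eq_smallest (σ := [1, 2, 3, 4]) (τ := [2, 3, 4, 5])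
      (by decide) (by decide) (by decide) n
  have hF := wordCount_rowF n
  have hL := wordCount_rowL n
  have hR := wordCount_rowR n
  have hY := wordCount_rowY n
  simp only [List.forall_mem_cons, List.not_mem_nil, false_implies, implies_true, and_true]
    at hF hL hR hY
  simp only [classTable, List.forall_mem_cons, List.not_mem_nil, false_implies, implies_true,
    and_true, List.headD_cons, hA, hB, hC, hF, hG, hL, hM, hR, hS, hV, hX, hY, hZ]

/-! ### The classification -/

theorem nodup_headD_and_length_headD : ∀ row ∈ classTable,
    (row.headD []).Nodup ∧ (row.headD []).length = 5 := by
  decide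

theorem wordCount_ten {w : List ℕ} (hw : w.Nodup) (hlen : w.length = 5) :
    wordCount w 10 = wordCountTen w :=
  match w, hlen with
  | [_, _, _, _, _], _ => wordCount_eq_sum_countTable hw 7

theorem map_wordCountTen_classTable :
    classTable.map (fun row => wordCountTen (row.headD [])) =
      [3236090, 3236740, 3236426, 3237362, 3237698, 3237620, 3238028, 3238886, 3238891, 3239356,
        3239412, 3240416, 3241219, 3243505, 3241738, 3242069, 3242738, 3243252, 3245568, 3246798,
        3247036, 3247430, 3249227, 3251054, 3253240, 3289057] := by
  decide +kernel

/-- Ten is the least length that works: H and I have the same counts up to length nine. -/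
theorem classTable_eq_of_wordCount_eq {row row' : List (List ℕ)} (h : row ∈ classTable)
    (h' : row' ∈ classTable) (he : wordCount (row.headD []) 10 = wordCount (row'.headD []) 10) :
    row = row' := by
  obtain ⟨hnd, hlen⟩ := nodup_headD_and_length_headD row h
  obtain ⟨hnd', hlen'⟩ := nodup_headD_and_length_headD row' h'
  rw [wordCount_ten hnd hlen, wordCount_ten hnd' hlen'] at he
  refine List.inj_on_of_nodup_map (f := fun row => wordCountTen (row.headD [])) ?_ h h' he
  rw [map_wordCountTen_classTable]
  decide

theorem exists_mem_classTable : ∀ σ : Equiv.Perm (Fin 5), ∃ row ∈ classTable,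
    (List.ofFn fun i => (σ i : ℕ) + 1) ∈ row ∨
      ((List.ofFn fun i => (σ i : ℕ) + 1).map (6 - ·)) ∈ row := by
  decide +kernel

theorem exists_word_mem_row : ∀ row ∈ classTable,
    ∃ σ : Equiv.Perm (Fin 5), (List.ofFn fun i => (σ i : ℕ) + 1) ∈ row := by
  decide +kernel

theorem exists_mem_tableClass (p : QuasiConsecutivePattern 5) :
    ∃ row ∈ classTable, p ∈ tableClass row := by
  obtain ⟨row, hrow, h⟩ := exists_mem_classTable p.1.perm
  refine ⟨row, hrow, ?_⟩
  rwa [tableClass, Set.mem_ofPred_eq, VincularPattern.word_complement]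

theorem tableClass_nonempty {row : List (List ℕ)} (h : row ∈ classTable) :
    (tableClass row).Nonempty := by
  obtain ⟨σ, hσ⟩ := exists_word_mem_row row h
  exact ⟨⟨⟨σ, {j | (j : ℕ) + 2 < 5}⟩, fun _ => Iff.rfl⟩, Or.inl hσ⟩

theorem ncard_avoiders_of_mem_tableClass {row : List (List ℕ)} (h : row ∈ classTable)
    {p : QuasiConsecutivePattern 5} (hp : p ∈ tableClass row) (n : ℕ) :
    (p.1.avoiders n).ncard = wordCount (row.headD []) n := by
  rw [VincularPattern.ncard_avoiders p.2]
  rcases hp with hp | hp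
  · exact wordCount_eq_headD n row h _ hp
  · rw [← p.1.wordCount_word_complement, wordCount_eq_headD n row h _ hp]

theorem wilfEquiv_iff_mem_tableClass {row : List (List ℕ)} (h : row ∈ classTable)
    {p : QuasiConsecutivePattern 5} (hp : p ∈ tableClass row) (q : QuasiConsecutivePattern 5) :
    wilfSetoid 5 q p ↔ q ∈ tableClass row := by
  constructor
  · intro hqp
    obtain ⟨row', h', hq⟩ := exists_mem_tableClass q
    have hten := hqp 10 (by norm_num)
    rw [ncard_avoiders_of_mem_tableClass h hp, ncard_avoiders_of_mem_tableClass h' hq] at hten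
    rwa [classTable_eq_of_wordCount_eq h h' hten.symm]
  · intro hq n _
    rw [ncard_avoiders_of_mem_tableClass h hp, ncard_avoiders_of_mem_tableClass h hq]

theorem classes_wilfSetoid_five :
    (wilfSetoid 5).classes = {C | ∃ row ∈ classTable, C = tableClass row} := by
  ext C
  constructor
  · rintro ⟨p, rfl⟩
    obtain ⟨row, h, hp⟩ := exists_mem_tableClass p
    exact ⟨row, h, Set.ext fun q => wilfEquiv_iff_mem_tableClass h hp q⟩
  · rintro ⟨row, h, rfl⟩
    obtain ⟨p, hp⟩ := tableClass_nonempty h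
    exact ⟨p, Set.ext fun q => (wilfEquiv_iff_mem_tableClass h hp q).symm⟩

theorem tableClass_injOn : Set.InjOn tableClass {row | row ∈ classTable} := by
  intro row h row' h' he
  obtain ⟨p, hp⟩ := tableClass_nonempty h
  refine classTable_eq_of_wordCount_eq h h' ?_
  rw [← ncard_avoiders_of_mem_tableClass h hp, ← ncard_avoiders_of_mem_tableClass h' (he ▸ hp)]

/-- The Wilf-equivalence classes of the quasi-consecutive patterns `abcd-e` of length 5 are exactly
the 26 rows of the table, and these are 26 different classes. -/
theorem mainTheorem1 :
    (wilfSetoid 5).classes = {C | ∃ row ∈ classTable, C = tableClass row} ∧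
      (wilfSetoid 5).classes.ncard = 26 := by
  refine ⟨classes_wilfSetoid_five, ?_⟩
  have himage : {C | ∃ row ∈ classTable, C = tableClass row} =
      tableClass '' {row | row ∈ classTable} := by
    ext C
    simp only [Set.mem_ofPred_eq, Set.mem_image, eq_comm]
  have hset : {row | row ∈ classTable} = (classTable.toFinset : Set (List (List ℕ))) := by
    ext row
    simp
  rw [classes_wilfSetoid_five, himage, tableClass_injOn.ncard_image, hset,
    Set.ncard_coe_finset]
  decide +kernel
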